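/- **Setting.** Consider a sequence of samples with total size $n=\sum_{j\le n_g}n_j\to\infty$, made of groups $j=1,\dots,n_g$ with units $i=1,\dots,n_j$ (all objects may depend on $n$), and the regression $$y_{i,j}=d_j\beta+w_{i,j}^\top\gamma+\varepsilon_{i,j},\qquad \varepsilon_{i,j}=\sum_{l=1}^L\sigma_l(d_j)\,\varepsilon^*_{l,i,j},$$ where $d_j$ is a scalar regressor that is constant within groups, $w_{i,j}$ is a random vector of controls of fixed dimension, $\sigma_1,\dots,\sigma_L$ are measurable functions ($L$ fixed), and the vectors $e_{i,j}=(\varepsilon^*_{l,i,j})_{l\le L}$ have mean zero, with group sums $\sum_{i\le n_j}e_{i,j}$ of finite second moment. Let $\hat\theta=(\hat\beta,\hat\gamma^\top)^\top=(\mathbf X^\top\mathbf X)^{-1}\mathbf X^\top\mathbf Y$ be the OLS estimator, the rows of $\mathbf X$ being $(d_j,w_{i,j}^\top)$ and the entries of $\mathbf Y$ being $y_{i,j}$. Let $\mu_d$, $\sigma_d^2$ be the mean and variance of $d_j$ and put $d_j^*=d_j-\mu_d$, $A_j=d_j^*(\sigma_l(d_j))_{l\le L}$, $\mu_A=\mathbb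 E[A_j]$, $\kappa_n=(\sum_{j\le n_g}n_j^2)^{1/2}$, $$S_\varepsilon^2=\frac1n\sum_{j\le n_g}\mathbb E\Big[\Big(\sum_{i\le n_j}\varepsilon_{i,j}\Big)^2\Big],\quad S_{e,1}^2=\frac1n\sum_{j\le n_g}\mathbb E\Big[\Big((A_j-\mu_A)^\top\sum_{i\le n_j}e_{i,j}\Big)^2\Big],\quad S_{e,2}^2=\mathbb E\Big[\Big(n^{-1/2}\sum_{j\le n_g}\sum_{i\le n_j}\mu_A^\top e_{i,j}\Big)^2\Big],$$ and $S_{d\varepsilon}^2=S_{e,1}^2+S_{e,2}^2$ (all these $S$'s being nonnegative). Let $K>0$ be a constant that does not depend on $n$. **Assumptions.** 1. (Regressor) The $d_j$ are i.i.d.; $(d_j)_j$ is independent of $(w_{i,j})_{i,j}$; $\mathbb E[|d_j|^4]\le K$; $\sigma_d^2\ge K^{-1}$. 2. (Controls) $\lambda_{\min}\big(n^{-1}\sum_j\sum_i w_{i,j}w_{i,j}^\top\big)\ge K^{-1}+o_p(1)$; $\max_{i,j}\mathbb E[\|w_{i,j}\|^2]\le K$; the first component of all $w_{i,j}$ is a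 non-zero constant. 3. (Errors) $n^{-1}\sum_j\sum_i w_{i,j}\varepsilon_{i,j}=o_p(S_\varepsilon n^{1/2}/\kappa_n)$; $S_\varepsilon^{-2}n^{-1}\sum_j(\sum_i\varepsilon_{i,j})^2\to_p1$; for some constant $\delta\in(0,2]$, $n^{-1-\delta/2}\sum_j|\sum_i\varepsilon_{i,j}|^{2+\delta}=o_p(S_\varepsilon^{2+\delta})$; $\kappa_n/n\to0$. 4. (Heteroscedasticity) $(d_j)_j$ is independent of $(e_{i,j})_{i,j}$; on the values taken by $d_j$, the functions $\sigma_l$ are bounded by $K$; $S_\varepsilon>0$ and $S_{e,1}/S_\varepsilon\ge K^{-1}$. 5. (Scaled errors) $\big\|n^{-1}\sum_j(\sum_i e_{i,j})(\sum_i e_{i,j})^\top-n^{-1}\sum_j\mathbb E[(\sum_i e_{i,j})(\sum_i e_{i,j})^\top]\big\|=o_p(S_{e,1}^2)$; $n^{-2}\sum_j\|\sum_i e_{i,j}\|^4=o_p(S_{e,1}^4)$; $S_{e,2}^{-1}n^{-1/2}\sum_j\sum_i\mu_A^\top e_{i,j}\to_dN(0,1)$. **Theorem.** Under these assumptions, $$\frac{\sqrt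 n(\hat\beta-\beta)}{S_{d\varepsilon}/\sigma_d^2}=\frac{n^{-1/2}\sum_{j\le n_g}d_j^*\sum_{i\le n_j}\varepsilon_{i,j}}{S_{d\varepsilon}}+o_p(1)\ \longrightarrow_d\ N(0,1).$$ -/

import Mathlib

open MeasureTheory ProbabilityTheory Filter Topology
open scoped Matrix

noncomputable section

/-- The stochastic order symbol `X_k = o_p(a_k)`, i.e. `X_k / a_k → 0` in probability
(used with positive scales `a_k`). -/
def IsLittleOP {Ω : Type*} [MeasurableSpace Ω] (P : Measure Ω)
    (E : Type*) [NormedAddCommGroup E] [NormedSpace ℝ E]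
    (X : ℕ → Ω → E) (a : ℕ → ℝ) : Prop :=
  TendstoInMeasure P (fun k ω => (a k)⁻¹ • X k ω) atTop (fun _ => (0 : E))

/-- The smallest eigenvalue of a real (symmetric, nonempty) matrix. -/
def lambdaMin {ι : Type*} [Fintype ι] [DecidableEq ι] (A : Matrix ι ι ℝ) : ℝ :=
  sInf (spectrum ℝ A)

/-- The data of one grouped sample: units `(j, i)` with `j` the group and `i < size j` the unit,
group-level regressor `d j`, controls `w j i` (with `p + 1` components, the component `0` being
the intercept), latent error vectors `e j i` (with `L` components), scale functions `σ l`,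
coefficients `β`, `γ`, and the common law of the regressors `d j`. -/
structure GroupSample (Ω : Type*) [MeasurableSpace Ω] (L p : ℕ) where
  numGroups : ℕ
  size : Fin numGroups → ℕ
  d : Fin numGroups → Ω → ℝ
  w : (j : Fin numGroups) → Fin (size j) → Ω → EuclideanSpace ℝ (Fin (p + 1))
  e : (j : Fin numGroups) → Fin (size j) → Ω → EuclideanSpace ℝ (Fin L)
  σ : Fin L → ℝ → ℝ
  β : ℝ
  γ : EuclideanSpace ℝ (Fin (p + 1))
  law : Measure ℝ

namespace GroupSample

variable {Ω : Type*} [MeasurableSpace Ω] {L p : ℕ}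

/-- The set of units. -/
abbrev Units (S : GroupSample Ω L p) : Type := (j : Fin S.numGroups) × Fin (S.size j)

/-- The sample size `n = ∑ⱼ nⱼ`, as a real number. -/
def n (S : GroupSample Ω L p) : ℝ := ((∑ j, S.size j : ℕ) : ℝ)

/-- `κ = (∑ⱼ nⱼ²)^{1/2}`. -/
def kappa (S : GroupSample Ω L p) : ℝ := √(∑ j, (S.size j : ℝ) ^ 2)

/-- The regression errors `ε_{ij} = ∑ₗ σₗ(dⱼ) ε*_{l,ij}`. -/
def eps (S : GroupSample Ω L p) (j : Fin S.numGroups) (i : Fin (S.size j)) (ω : Ω) : ℝ :=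
  ∑ l, S.σ l (S.d j ω) * S.e j i ω l

/-- The outcomes `y_{ij} = dⱼ β + w_{ij}ᵀ γ + ε_{ij}`. -/
def y (S : GroupSample Ω L p) (j : Fin S.numGroups) (i : Fin (S.size j)) (ω : Ω) : ℝ :=
  S.d j ω * S.β + inner ℝ (S.w j i ω) S.γ + S.eps j i ω

/-- The matrix `𝐗` of regressors: one row `(dⱼ, w_{ij}ᵀ)` for each unit. -/
def X (S : GroupSample Ω L p) (ω : Ω) : Matrix S.Units (Unit ⊕ Fin (p + 1)) ℝ :=
  Matrix.of fun u => Sum.elim (fun _ => S.d u.1 ω) (fun c => S.w u.1 u.2 ω c)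

/-- The vector `𝐘` of outcomes. -/
def Y (S : GroupSample Ω L p) (ω : Ω) : S.Units → ℝ := fun u => S.y u.1 u.2 ω

/-- The least squares estimator `θ̂ = (𝐗ᵀ𝐗)⁻¹ 𝐗ᵀ𝐘`. -/
def thetaHat (S : GroupSample Ω L p) (ω : Ω) : Unit ⊕ Fin (p + 1) → ℝ :=
  ((S.X ω)ᵀ * S.X ω)⁻¹ *ᵥ ((S.X ω)ᵀ *ᵥ S.Y ω)

/-- `β̂`, the coefficient of `d` in `θ̂`. -/
def betaHat (S : GroupSample Ω L p) (ω : Ω) : ℝ := S.thetaHat ω (Sum.inl ())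

/-- The normalized Gram matrix `n⁻¹ ∑ⱼ ∑ᵢ w_{ij} w_{ij}ᵀ`. -/
def gramW (S : GroupSample Ω L p) (ω : Ω) : Matrix (Fin (p + 1)) (Fin (p + 1)) ℝ :=
  S.n⁻¹ • ∑ j, ∑ i, Matrix.vecMulVec (S.w j i ω) (S.w j i ω)

/-- `μ_d`, the mean of the regressor. -/
def muD (S : GroupSample Ω L p) : ℝ := ∫ x, x ∂S.law

/-- `σ_d²`, the variance of the regressor. -/
def varD (S : GroupSample Ω L p) : ℝ := ∫ x, (x - S.muD) ^ 2 ∂S.law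

/-- `(x - μ_d) (σₗ(x))ₗ`, so that `Aⱼ` is its value at `x = dⱼ`. -/
def Afun (S : GroupSample Ω L p) (x : ℝ) : EuclideanSpace ℝ (Fin L) :=
  WithLp.toLp 2 fun l => (x - S.muD) * S.σ l x

/-- `Aⱼ = (dⱼ - μ_d) (σₗ(dⱼ))ₗ`. -/
def A (S : GroupSample Ω L p) (j : Fin S.numGroups) (ω : Ω) : EuclideanSpace ℝ (Fin L) :=
  S.Afun (S.d j ω)

/-- `μ_A`, the common mean vector of the `Aⱼ`. -/
def muA (S : GroupSample Ω L p) : EuclideanSpace ℝ (Fin L) :=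
  WithLp.toLp 2 fun l => ∫ x, S.Afun x l ∂S.law

/-- The group sums `∑ᵢ ε_{ij}`. -/
def epsSum (S : GroupSample Ω L p) (j : Fin S.numGroups) (ω : Ω) : ℝ := ∑ i, S.eps j i ω

/-- The group sums `∑ᵢ e_{ij}`. -/
def eSum (S : GroupSample Ω L p) (j : Fin S.numGroups) (ω : Ω) : EuclideanSpace ℝ (Fin L) :=
  ∑ i, S.e j i ω

/-- `S_ε = (n⁻¹ ∑ⱼ 𝔼[(∑ᵢ ε_{ij})²])^{1/2}`. -/
def Seps (S : GroupSample Ω L p) (P : Measure Ω) : ℝ :=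
  √(S.n⁻¹ * ∑ j, ∫ ω, S.epsSum j ω ^ 2 ∂P)

/-- `S_{e,1} = (n⁻¹ ∑ⱼ 𝔼[((Aⱼ - μ_A)ᵀ ∑ᵢ e_{ij})²])^{1/2}`. -/
def Se1 (S : GroupSample Ω L p) (P : Measure Ω) : ℝ :=
  √(S.n⁻¹ * ∑ j, ∫ ω, (inner ℝ (S.A j ω - S.muA) (S.eSum j ω)) ^ 2 ∂P)

/-- `n^{-1/2} ∑ⱼ ∑ᵢ μ_Aᵀ e_{ij}`. -/
def meanScore (S : GroupSample Ω L p) (ω : Ω) : ℝ :=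
  (√S.n)⁻¹ * ∑ j, ∑ i, inner ℝ S.muA (S.e j i ω)

/-- `S_{e,2} = (𝔼[(n^{-1/2} ∑ⱼ ∑ᵢ μ_Aᵀ e_{ij})²])^{1/2}`. -/
def Se2 (S : GroupSample Ω L p) (P : Measure Ω) : ℝ := √(∫ ω, S.meanScore ω ^ 2 ∂P)

/-- `S_{dε}`, given by `S_{dε}² = S_{e,1}² + S_{e,2}²`. -/
def Sdeps (S : GroupSample Ω L p) (P : Measure Ω) : ℝ := √(S.Se1 P ^ 2 + S.Se2 P ^ 2)

/-- The score `n^{-1/2} ∑ⱼ (dⱼ - μ_d) ∑ᵢ ε_{ij}`. -/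
def score (S : GroupSample Ω L p) (ω : Ω) : ℝ :=
  (√S.n)⁻¹ * ∑ j, (S.d j ω - S.muD) * S.epsSum j ω

/-- `√n (β̂ - β) / (S_{dε} / σ_d²)`. -/
def tStat (S : GroupSample Ω L p) (P : Measure Ω) (ω : Ω) : ℝ :=
  √S.n * (S.betaHat ω - S.β) / (S.Sdeps P / S.varD)

/-- `n⁻¹ ∑ⱼ (∑ᵢ e_{ij}) (∑ᵢ e_{ij})ᵀ`. -/
def outerE (S : GroupSample Ω L p) (ω : Ω) : Matrix (Fin L) (Fin L) ℝ :=
  S.n⁻¹ • ∑ j, Matrix.vecMulVec (S.eSum j ω) (S.eSum j ω)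

/-- `n⁻¹ ∑ⱼ 𝔼[(∑ᵢ e_{ij}) (∑ᵢ e_{ij})ᵀ]`. -/
def meanOuterE (S : GroupSample Ω L p) (P : Measure Ω) : Matrix (Fin L) (Fin L) ℝ :=
  S.n⁻¹ • ∑ j, Matrix.of fun l m => ∫ ω, S.eSum j ω l * S.eSum j ω m ∂P

/-- Standing conventions: `w` and `e` are random vectors, the `e_{ij}` have mean zero, their group
sums have finite second moments, and the functions `σₗ` are measurable. -/
structure IsModel (S : GroupSample Ω L p) (P : Measure Ω) : Prop where
  measurable_w : ∀ j i, Measurable (S.w j i)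
  measurable_e : ∀ j i, Measurable (S.e j i)
  measurable_σ : ∀ l, Measurable (S.σ l)
  integrable_e : ∀ j i, Integrable (S.e j i) P
  mean_e : ∀ j i, ∫ ω, S.e j i ω ∂P = 0
  memLp_eSum : ∀ j, MemLp (S.eSum j) 2 P

/-- Conditions on the regressor of interest. -/
structure RegressorCond (S : GroupSample Ω L p) (P : Measure Ω) (K : ℝ) : Prop where
  hasLaw : ∀ j, HasLaw (S.d j) S.law P
  indep : iIndepFun S.d P
  indep_w : IndepFun (fun ω j => S.d j ω) (fun ω j i => S.w j i ω) P
  memLp_d : ∀ j, MemLp (S.d j) 4 P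
  moment_d : ∀ j, ∫ ω, |S.d j ω| ^ 4 ∂P ≤ K
  varD_ge : K⁻¹ ≤ S.varD

end GroupSample

variable {Ω : Type*} [MeasurableSpace Ω] {L p : ℕ}

/-- Conditions on the controls along a sequence of samples. The first condition reads
`λ_min(n⁻¹ ∑ⱼ ∑ᵢ w_{ij} w_{ij}ᵀ) ≥ K⁻¹ + o_p(1)`. -/
structure ControlsCond (S : ℕ → GroupSample Ω L p) (P : Measure Ω) (K : ℝ) : Prop where
  lambdaMin_ge : ∃ R : ℕ → Ω → ℝ, TendstoInMeasure P R atTop (fun _ => (0 : ℝ)) ∧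
    ∀ k, ∀ᵐ ω ∂P, K⁻¹ + R k ω ≤ lambdaMin ((S k).gramW ω)
  memLp_w : ∀ k j i, MemLp ((S k).w j i) 2 P
  moment_w : ∀ k j i, ∫ ω, ‖(S k).w j i ω‖ ^ 2 ∂P ≤ K
  intercept : ∀ k, ∃ c : ℝ, c ≠ 0 ∧ ∀ j i ω, (S k).w j i ω 0 = c

/-- Conditions on the regression errors along a sequence of samples. -/
structure ErrorsCond (S : ℕ → GroupSample Ω L p) (P : Measure Ω) : Prop where
  orthogonality : IsLittleOP P (EuclideanSpace ℝ (Fin (p + 1)))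
    (fun k ω => (S k).n⁻¹ • ∑ j, ∑ i, (S k).eps j i ω • (S k).w j i ω)
    (fun k => (S k).Seps P * √(S k).n / (S k).kappa)
  lln : TendstoInMeasure P
    (fun k ω => ((S k).Seps P ^ 2)⁻¹ * ((S k).n⁻¹ * ∑ j, (S k).epsSum j ω ^ 2))
    atTop (fun _ => (1 : ℝ))
  moment : ∃ δ : ℝ, 0 < δ ∧ δ ≤ 2 ∧ IsLittleOP P ℝ
    (fun k ω => (S k).n ^ (-1 - δ / 2) * ∑ j, |(S k).epsSum j ω| ^ (2 + δ))
    (fun k => (S k).Seps P ^ (2 + δ))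
  size : Tendsto (fun k => (S k).kappa / (S k).n) atTop (𝓝 0)

/-- Conditions on the conditional heteroscedasticity. The functions `σₗ` have to be bounded only on
the values that the regressor takes, such as `{0, 1}` for a binary treatment. -/
structure HeteroCond (S : ℕ → GroupSample Ω L p) (P : Measure Ω) (K : ℝ) : Prop where
  indep_e : ∀ k, IndepFun (fun ω j => (S k).d j ω) (fun ω j i => (S k).e j i ω) P
  bounded_σ : ∀ k l, ∀ᵐ x ∂(S k).law, |(S k).σ l x| ≤ K
  Se1_ge : ∀ k, K⁻¹ ≤ (S k).Se1 P / (S k).Seps P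

/-- Conditions on the latent error vectors. The norm of a matrix is its operator norm with respect
to the Euclidean norm. -/
structure LatentCond (S : ℕ → GroupSample Ω L p) (P : Measure Ω) [IsProbabilityMeasure P] :
    Prop where
  lln : IsLittleOP P ℝ
    (fun k ω => ‖Matrix.toEuclideanCLM (n := Fin L) (𝕜 := ℝ)
      ((S k).outerE ω - (S k).meanOuterE P)‖)
    (fun k => (S k).Se1 P ^ 2)
  moment : IsLittleOP P ℝ
    (fun k ω => ((S k).n ^ 2)⁻¹ * ∑ j, ‖(S k).eSum j ω‖ ^ 4)
    (fun k => (S k).Se1 P ^ 4)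
  clt : TendstoInDistribution (fun k ω => ((S k).Se2 P)⁻¹ * (S k).meanScore ω)
    atTop id (fun _ => P) (gaussianReal 0 1)

end

/-! The argument has two independent halves, a linearization of the estimator and a central limit
theorem for the score.

Linearization (`tendstoInMeasure_tStat_sub`). Since the controls contain an intercept, the regressor
may be centered at `μ_d` without changing `β̂`. Let G be the Gram matrix of the controls, q the
cross moment of `d - μ_d` with `w`, and r that of `w` with `ε`. Partialling out the controls gives
an exact identity (`exists_betaHat_sub_mul`): `β̂ - β` times (empirical second moment of `d - μ_d`
minus qᵀG⁻¹q) is `n^{-1/2}` times the score minus qᵀG⁻¹r. Independence of `d` and `w` gives q =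
O_p(κ/n) and the empirical second moment converges to `σ_d²`, both by second-moment bounds
(`integral_sq_sum_mul`). As r = o_p(S_ε √n / κ), the remainder √n qᵀG⁻¹r is o_p(S_ε), which is
negligible because S_ε ≤ K S_{e,1} ≤ K S_{dε}.

Limit theorem (`tendstoInDistribution_score`). The score is the sum of `n^{-1/2} ∑ⱼ (Aⱼ - μ_A)ᵀ ∑ᵢ
e_{ij}` and a term depending on the errors only (`score_eq`). Given the errors, the first part is a
sum of independent centered terms. Its conditional variance is an average of quadratic forms in the
outer products of the error sums, hence close to S_{e,1}² (`abs_condVar_sub_le`), and its fourth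
moments are negligible. So its conditional characteristic function is close to the nonrandom number
exp(-t² S_{e,1}² / (2 S_{dε}²)) (`norm_prod_charFun_scoreLaw_sub_le`). Being nonrandom, this factor
leaves the expectation, and what remains is the characteristic function of the second part, close to
exp(-t² S_{e,2}² / (2 S_{dε}²)). The exponents add up to -t²/2. The shares of the two variances need
not converge, so the last approximation is needed along bounded, possibly oscillating arguments
(`tendsto_charFun_sub_of_bounded`). -/

/-! ### Calculus of o_p and O_p. -/

section ConvergenceInProbability

variable {Ω : Type*} [MeasurableSpace Ω] {P : Measure Ω}

/-- A sequence of real random variables is bounded in probability. -/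
def BddInProb (P : Measure Ω) (X : ℕ → Ω → ℝ) : Prop :=
  ∀ ε : ℝ, 0 < ε → ∃ M : ℝ, 0 < M ∧ ∀ k, P {ω | M ≤ |X k ω|} ≤ ENNReal.ofReal ε

lemma tendstoInMeasure_zero_iff {X : ℕ → Ω → ℝ} :
    TendstoInMeasure P X atTop (fun _ => (0 : ℝ)) ↔
      ∀ ε : ℝ, 0 < ε → Tendsto (fun k => P {ω | ε ≤ |X k ω|}) atTop (𝓝 0) := by
  simp [tendstoInMeasure_iff_norm, Real.norm_eq_abs]

/-- Convergence in probability to zero from a family of dominations, one for each level. -/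
lemma tendstoInMeasure_zero_of_forall_lt {X : ℕ → Ω → ℝ}
    (h : ∀ ε : ℝ, 0 < ε → ∃ (Y Z : ℕ → Ω → ℝ) (a b : ℝ), 0 < a ∧ 0 < b ∧
      TendstoInMeasure P Y atTop (fun _ => (0 : ℝ)) ∧
      TendstoInMeasure P Z atTop (fun _ => (0 : ℝ)) ∧
      ∀ k, ∀ᵐ ω ∂P, |Y k ω| < a → |Z k ω| < b → |X k ω| < ε) :
    TendstoInMeasure P X atTop (fun _ => (0 : ℝ)) := by
  rw [tendstoInMeasure_zero_iff]
  intro ε hε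
  obtain ⟨Y, Z, a, b, ha, hb, hY, hZ, hXYZ⟩ := h ε hε
  rw [tendstoInMeasure_zero_iff] at hY hZ
  have hlim : Tendsto (fun k => P {ω | a ≤ |Y k ω|} + P {ω | b ≤ |Z k ω|}) atTop (𝓝 0) := by
    simpa using (hY a ha).add (hZ b hb)
  refine tendsto_of_tendsto_of_tendsto_of_le_of_le tendsto_const_nhds hlim
    (fun _ => zero_le) fun k => ?_
  refine (measure_mono_ae ?_).trans (measure_union_le _ _)
  filter_upwards [hXYZ k] with ω hω (hx : ε ≤ |X k ω|)
  change a ≤ |Y k ω| ∨ b ≤ |Z k ω|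
  by_contra! hcon
  exact absurd (hω hcon.1 hcon.2) (not_lt.2 hx)

lemma tendstoInMeasure_zero_of_le {X Y : ℕ → Ω → ℝ}
    (hY : TendstoInMeasure P Y atTop (fun _ => (0 : ℝ)))
    (h : ∀ k, ∀ᵐ ω ∂P, |X k ω| ≤ |Y k ω|) :
    TendstoInMeasure P X atTop (fun _ => (0 : ℝ)) := by
  refine tendstoInMeasure_zero_of_forall_lt fun ε hε => ⟨Y, Y, ε, ε, hε, hε, hY, hY, fun k => ?_⟩
  filter_upwards [h k] with ω hω h1 _ using hω.trans_lt h1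

/-- Squeeze on an event whose probability tends to one. -/
lemma tendstoInMeasure_zero_of_le_of_lt {X Y Z : ℕ → Ω → ℝ} {c : ℝ} (hc : 0 < c)
    (hY : TendstoInMeasure P Y atTop (fun _ => (0 : ℝ)))
    (hZ : TendstoInMeasure P Z atTop (fun _ => (0 : ℝ)))
    (h : ∀ k, ∀ᵐ ω ∂P, |Z k ω| < c → |X k ω| ≤ |Y k ω|) :
    TendstoInMeasure P X atTop (fun _ => (0 : ℝ)) := by
  refine tendstoInMeasure_zero_of_forall_lt fun ε hε => ⟨Y, Z, ε, c, hε, hc, hY, hZ, fun k => ?_⟩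
  filter_upwards [h k] with ω hω h1 h2 using (hω h2).trans_lt h1

lemma tendstoInMeasure_zero_add {X Y : ℕ → Ω → ℝ}
    (hX : TendstoInMeasure P X atTop (fun _ => (0 : ℝ)))
    (hY : TendstoInMeasure P Y atTop (fun _ => (0 : ℝ))) :
    TendstoInMeasure P (fun k ω => X k ω + Y k ω) atTop (fun _ => (0 : ℝ)) := by
  refine tendstoInMeasure_zero_of_forall_lt fun ε hε =>
    ⟨X, Y, ε / 2, ε / 2, half_pos hε, half_pos hε, hX, hY, fun k => ae_of_all _ fun ω h1 h2 => ?_⟩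
  linarith [abs_add_le (X k ω) (Y k ω)]

lemma tendstoInMeasure_zero_abs {X : ℕ → Ω → ℝ}
    (hX : TendstoInMeasure P X atTop (fun _ => (0 : ℝ))) :
    TendstoInMeasure P (fun k ω => |X k ω|) atTop (fun _ => (0 : ℝ)) :=
  tendstoInMeasure_zero_of_le hX fun k => ae_of_all _ fun ω => by simp

/-- The product of a sequence bounded in probability and one that vanishes in probability. -/
lemma BddInProb.mul_tendstoInMeasure_zero {X Y : ℕ → Ω → ℝ} (hX : BddInProb P X)
    (hY : TendstoInMeasure P Y atTop (fun _ => (0 : ℝ))) :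
    TendstoInMeasure P (fun k ω => X k ω * Y k ω) atTop (fun _ => (0 : ℝ)) := by
  rw [tendstoInMeasure_zero_iff] at hY ⊢
  intro ε hε
  rw [ENNReal.tendsto_nhds_zero]
  intro η hη
  -- The level η lives in `ENNReal`, so a real δ is extracted, with η = ⊤ treated apart.
  obtain ⟨δ, hδ, hδη⟩ : ∃ δ : ℝ, 0 < δ ∧ ENNReal.ofReal δ ≤ η / 2 := by
    rcases eq_or_ne η ⊤ with rfl | hη'
    · exact ⟨1, one_pos, by simp [ENNReal.top_div]⟩
    · refine ⟨η.toReal / 2, half_pos (ENNReal.toReal_pos hη.ne' hη'), ?_⟩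
      rw [ENNReal.ofReal_div_of_pos two_pos, ENNReal.ofReal_toReal hη']
      simp
  obtain ⟨M, hM, hXM⟩ := hX δ hδ
  have h2 := (ENNReal.tendsto_nhds_zero.1 (hY (ε / M) (div_pos hε hM))) (η / 2)
    (ENNReal.half_pos hη.ne')
  filter_upwards [h2] with k hk
  calc P {ω | ε ≤ |X k ω * Y k ω|}
      ≤ P ({ω | M ≤ |X k ω|} ∪ {ω | ε / M ≤ |Y k ω|}) := by
        refine measure_mono fun ω (hω : ε ≤ |X k ω * Y k ω|) => ?_
        change M ≤ |X k ω| ∨ ε / M ≤ |Y k ω|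
        by_contra! hcon
        rw [abs_mul] at hω
        have h1 : |X k ω| * |Y k ω| ≤ M * |Y k ω| :=
          mul_le_mul_of_nonneg_right hcon.1.le (abs_nonneg _)
        have h3 : |Y k ω| * M < ε := (lt_div_iff₀ hM).1 hcon.2
        linarith
    _ ≤ P {ω | M ≤ |X k ω|} + P {ω | ε / M ≤ |Y k ω|} := measure_union_le _ _
    _ ≤ η / 2 + η / 2 := add_le_add ((hXM k).trans hδη) hk
    _ = η := ENNReal.add_halves η

lemma bddInProb_const (P : Measure Ω) [IsProbabilityMeasure P] (c : ℝ) :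
    BddInProb P (fun _ _ => c) := by
  intro ε hε
  exact ⟨|c| + 1, by positivity, fun k => by norm_num⟩

lemma tendstoInMeasure_zero_const_mul [IsProbabilityMeasure P] {X : ℕ → Ω → ℝ} (c : ℝ)
    (hX : TendstoInMeasure P X atTop (fun _ => (0 : ℝ))) :
    TendstoInMeasure P (fun k ω => c * X k ω) atTop (fun _ => (0 : ℝ)) :=
  (bddInProb_const P c).mul_tendstoInMeasure_zero hX

lemma tendstoInMeasure_zero_of_tendsto [IsProbabilityMeasure P] {a : ℕ → ℝ}
    (ha : Tendsto a atTop (𝓝 0)) :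
    TendstoInMeasure P (fun k (_ : Ω) => a k) atTop (fun _ => (0 : ℝ)) :=
  tendstoInMeasure_of_tendsto_ae (fun _ => aestronglyMeasurable_const) (ae_of_all _ fun _ => ha)

lemma measure_le_of_integral_sq_le [IsProbabilityMeasure P] {X : Ω → ℝ} {C M : ℝ} (hM : 0 < M)
    (hint : Integrable (fun ω => X ω ^ 2) P) (hC : ∫ ω, X ω ^ 2 ∂P ≤ C) :
    P {ω | M ≤ |X ω|} ≤ ENNReal.ofReal (C / M ^ 2) := by
  have h := mul_meas_ge_le_integral_of_nonneg (ae_of_all _ fun ω => sq_nonneg (X ω)) hint (M ^ 2)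
  have hset : {ω | M ^ 2 ≤ X ω ^ 2} = {ω | M ≤ |X ω|} := by
    ext ω
    simp only [Set.mem_ofPred_eq]
    rw [← sq_abs (X ω), sq_le_sq₀ hM.le (abs_nonneg _)]
  rw [hset] at h
  rw [← ofReal_measureReal (measure_ne_top P _)]
  refine ENNReal.ofReal_le_ofReal ?_
  rw [le_div_iff₀ (by positivity)]
  linarith

/-- Bounded second moments imply boundedness in probability. -/
lemma bddInProb_of_integral_sq_le [IsProbabilityMeasure P] {X : ℕ → Ω → ℝ} {C : ℝ}
    (hint : ∀ k, Integrable (fun ω => X k ω ^ 2) P) (hC : ∀ k, ∫ ω, X k ω ^ 2 ∂P ≤ C) :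
    BddInProb P X := by
  have hC0 : 0 ≤ C := (integral_nonneg fun ω => sq_nonneg (X 0 ω)).trans (hC 0)
  intro ε hε
  -- C + 1 keeps M positive when C = 0; then C / M² = Cε / (C + 1) ≤ ε.
  refine ⟨√((C + 1) / ε), by positivity, fun k => ?_⟩
  refine (measure_le_of_integral_sq_le (by positivity) (hint k) (hC k)).trans ?_
  refine ENNReal.ofReal_le_ofReal ?_
  rw [Real.sq_sqrt (by positivity), div_div_eq_mul_div, div_le_iff₀ (by positivity)]
  nlinarith

/-- Vanishing second moments imply convergence in probability. -/
lemma tendstoInMeasure_zero_of_integral_sq_le [IsProbabilityMeasure P] {X : ℕ → Ω → ℝ} {a : ℕ → ℝ}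
    (hint : ∀ k, Integrable (fun ω => X k ω ^ 2) P) (hle : ∀ k, ∫ ω, X k ω ^ 2 ∂P ≤ a k)
    (ha : Tendsto a atTop (𝓝 0)) :
    TendstoInMeasure P X atTop (fun _ => (0 : ℝ)) := by
  rw [tendstoInMeasure_zero_iff]
  intro ε hε
  have hlim : Tendsto (fun k => ENNReal.ofReal (a k / ε ^ 2)) atTop (𝓝 0) := by
    simpa using ENNReal.tendsto_ofReal (ha.div_const (ε ^ 2))
  exact tendsto_of_tendsto_of_tendsto_of_le_of_le tendsto_const_nhds hlim (fun _ => zero_le)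
    fun k => measure_le_of_integral_sq_le hε (hint k) (hle k)

lemma BddInProb.sum_abs {ι : Type*} [IsProbabilityMeasure P] (s : Finset ι) {X : ι → ℕ → Ω → ℝ}
    (hX : ∀ i ∈ s, BddInProb P (X i)) : BddInProb P (fun k ω => ∑ i ∈ s, |X i k ω|) := by
  classical
  induction s using Finset.induction_on with
  | empty => simpa using bddInProb_const P 0
  | insert i s hi ih =>
    intro ε hε
    obtain ⟨M, hM, h1⟩ := hX i (Finset.mem_insert_self i s) (ε / 2) (half_pos hε)
    obtain ⟨N, hN, h2⟩ := ih (fun j hj => hX j (Finset.mem_insert_of_mem hj)) (ε / 2) (half_pos hε)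
    refine ⟨M + N, add_pos hM hN, fun k => ?_⟩
    calc P {ω | M + N ≤ abs (∑ j ∈ insert i s, |X j k ω|)}
        ≤ P ({ω | M ≤ |X i k ω|} ∪ {ω | N ≤ abs (∑ j ∈ s, |X j k ω|)}) := by
          refine measure_mono fun ω (hω : M + N ≤ abs (∑ j ∈ insert i s, |X j k ω|)) => ?_
          change M ≤ |X i k ω| ∨ N ≤ abs (∑ j ∈ s, |X j k ω|)
          by_contra! hcon
          rw [Finset.sum_insert hi] at hω
          have := abs_add_le |X i k ω| (∑ j ∈ s, |X j k ω|)
          rw [abs_abs] at this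
          linarith [hcon.1, hcon.2]
      _ ≤ ENNReal.ofReal (ε / 2) + ENNReal.ofReal (ε / 2) :=
          (measure_union_le _ _).trans (add_le_add (h1 k) (h2 k))
      _ = ENNReal.ofReal ε := by
          rw [← ENNReal.ofReal_add (by positivity) (by positivity), add_halves]

lemma BddInProb.of_le {X Y : ℕ → Ω → ℝ} (hY : BddInProb P Y)
    (h : ∀ k, ∀ᵐ ω ∂P, |X k ω| ≤ |Y k ω|) : BddInProb P X := by
  intro ε hε
  obtain ⟨M, hM, hYM⟩ := hY ε hε
  refine ⟨M, hM, fun k => (measure_mono_ae ?_).trans (hYM k)⟩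
  filter_upwards [h k] with ω hω (h1 : M ≤ |X k ω|) using h1.trans hω

/-- A sequence that converges in distribution is bounded in probability. -/
lemma bddInProb_of_tendstoInDistribution [IsProbabilityMeasure P] {Ω' : Type*}
    [MeasurableSpace Ω'] {Q : Measure Ω'} [IsProbabilityMeasure Q] {X : ℕ → Ω → ℝ} {Z : Ω' → ℝ}
    (h : TendstoInDistribution X atTop Z (fun _ => P) Q) : BddInProb P X := by
  have hprob : ∀ k, IsProbabilityMeasure (P.map (X k)) := fun k =>
    Measure.isProbabilityMeasure_map (h.forall_aemeasurable k)
  have : IsProbabilityMeasure (Q.map Z) := Measure.isProbabilityMeasure_map h.aemeasurable_limit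
  -- Pointwise convergence of characteristic functions to a function continuous at 0 forces
  -- tightness; a compact set carrying almost all mass then yields M.
  have ht : IsTightMeasureSet (Set.range fun k => P.map (X k)) :=
    isTightMeasureSet_of_tendsto_charFun (f := charFun (Q.map Z))
      continuous_charFun.continuousAt (ProbabilityMeasure.tendsto_iff_tendsto_charFun.1 h.tendsto)
  rw [isTightMeasureSet_iff_exists_isCompact_measure_compl_le] at ht
  intro ε hε
  obtain ⟨T, hT, hle⟩ := ht (ENNReal.ofReal ε) (ENNReal.ofReal_pos.2 hε)
  obtain ⟨M, hM⟩ := hT.isBounded.exists_norm_le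
  refine ⟨|M| + 1, by positivity, fun k => ?_⟩
  refine le_trans ?_ (hle _ ⟨k, rfl⟩)
  rw [Measure.map_apply_of_aemeasurable (h.forall_aemeasurable k) hT.isClosed.measurableSet.compl]
  refine measure_mono fun ω (hω : |M| + 1 ≤ |X k ω|) hmem => ?_
  have := hM _ hmem
  rw [Real.norm_eq_abs] at this
  linarith [le_abs_self M]

/-- Bounded random variables that converge to zero in probability converge in mean. -/
lemma tendsto_integral_of_tendstoInMeasure_zero [IsProbabilityMeasure P] {X : ℕ → Ω → ℝ} {C : ℝ}
    (hX : TendstoInMeasure P X atTop (fun _ => (0 : ℝ))) (hC : ∀ k ω, |X k ω| ≤ C)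
    (hm : ∀ k, AEStronglyMeasurable (X k) P) :
    Tendsto (fun k => ∫ ω, X k ω ∂P) atTop (𝓝 0) := by
  -- Dominated convergence needs almost sure convergence, available along a further subsequence of
  -- every subsequence.
  refine tendsto_of_subseq_tendsto fun ns hns => ?_
  obtain ⟨ms, -, hae⟩ := (hX.comp hns).exists_seq_tendsto_ae'
  refine ⟨ms, ?_⟩
  have := tendsto_integral_of_dominated_convergence (μ := P) (F := fun i => X (ns (ms i)))
    (f := fun _ => (0 : ℝ)) (fun _ => C) (fun i => hm _) (integrable_const C)
    (fun i => ae_of_all _ fun ω => hC _ ω) hae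
  simpa using this

end ConvergenceInProbability

/-! ### Partialling out in least squares. -/

section LeastSquares

/-- The smallest eigenvalue bounds the quadratic form from below. -/
lemma lambdaMin_mul_norm_sq_le {ι : Type*} [Fintype ι] [DecidableEq ι] {A : Matrix ι ι ℝ}
    (hA : A.IsHermitian) (v : EuclideanSpace ℝ ι) :
    lambdaMin A * ‖v‖ ^ 2 ≤ v.ofLp ⬝ᵥ (A *ᵥ v.ofLp) := by
  have hev : ∀ i, lambdaMin A ≤ hA.eigenvalues i := fun i => by
    unfold lambdaMin
    rw [hA.spectrum_real_eq_range_eigenvalues]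
    exact csInf_le (Set.finite_range _).bddBelow ⟨i, rfl⟩
  have hvA : inner ℝ v (Matrix.toEuclideanLin A v) = v.ofLp ⬝ᵥ (A *ᵥ v.ofLp) := by
    simp [EuclideanSpace.inner_eq_star_dotProduct, dotProduct_comm, Matrix.toLpLin_apply]
  -- In an orthonormal eigenbasis both sides are sums of squared coordinates, weighted by the
  -- eigenvalues on the right.
  rw [← hvA, ← hA.eigenvectorBasis.sum_inner_mul_inner v (Matrix.toEuclideanLin A v),
    ← hA.eigenvectorBasis.sum_sq_norm_inner_right v, Finset.mul_sum]
  refine Finset.sum_le_sum fun i _ => ?_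
  have hsymm := (Matrix.isSymmetric_toEuclideanLin_iff.2 hA) (hA.eigenvectorBasis i) v
  have heig : Matrix.toEuclideanLin A (hA.eigenvectorBasis i)
      = hA.eigenvalues i • hA.eigenvectorBasis i := by
    have := hA.mulVec_eigenvectorBasis i
    rw [Matrix.toLpLin_apply, this]
    rfl
  rw [← hsymm, heig, inner_smul_left, real_inner_comm v, Real.norm_eq_abs, sq_abs]
  simp only [conj_trivial]
  rw [mul_left_comm, real_inner_comm]
  nlinarith [hev i, sq_nonneg (inner ℝ v (hA.eigenvectorBasis i))]

variable {U E : Type*} [Fintype U] [NormedAddCommGroup E] [InnerProductSpace ℝ E]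
  [FiniteDimensional ℝ E]

/-- Partialling out the controls `w` in the normal equations of the regression of `e` on `(D, w)`:
up to terms controlled by the cross moments of `w` with `D` and `e`, the coefficient of `D` is that
of the regression of `e` on `D` alone. -/
lemma exists_partial_out {n c : ℝ} (hc : 0 < c) (D e : U → ℝ) (w : U → E)
    (hG : ∀ v, c * ‖v‖ ^ 2 ≤ n⁻¹ * ∑ u, inner ℝ (w u) v ^ 2) (b : ℝ) (g : E)
    (h1 : ∑ u, D u * (D u * b + inner ℝ (w u) g - e u) = 0)
    (h2 : ∑ u, (D u * b + inner ℝ (w u) g - e u) • w u = 0) :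
    ∃ η ρ : ℝ, |η| ≤ ‖n⁻¹ • ∑ u, D u • w u‖ ^ 2 / c ∧
      |ρ| ≤ ‖n⁻¹ • ∑ u, D u • w u‖ * ‖n⁻¹ • ∑ u, e u • w u‖ / c ∧
      b * (n⁻¹ * ∑ u, D u ^ 2 - η) = n⁻¹ * ∑ u, D u * e u - ρ := by
  set q : E := n⁻¹ • ∑ u, D u • w u with hq
  set r : E := n⁻¹ • ∑ u, e u • w u with hr
  -- The Gram operator of the controls. `hG` makes it coercive, hence injective and, in finite
  -- dimension, onto.
  let T : E →ₗ[ℝ] E :=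
    { toFun := fun v => n⁻¹ • ∑ u, inner ℝ (w u) v • w u
      map_add' := fun x y => by simp [inner_add_right, add_smul, Finset.sum_add_distrib]
      map_smul' := fun a x => by
        simp only [inner_smul_right, mul_smul, RingHom.id_apply, ← Finset.smul_sum]
        exact smul_comm _ _ _ }
  have hTapp : ∀ x y, inner ℝ (T x) y = n⁻¹ * ∑ u, inner ℝ (w u) x * inner ℝ (w u) y := by
    intro x y
    simp [T, inner_smul_left, sum_inner]
  have hTge : ∀ v, c * ‖v‖ ^ 2 ≤ inner ℝ (T v) v := fun v => by
    rw [hTapp]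
    simpa [sq] using hG v
  have hTinj : Function.Injective T := by
    rw [injective_iff_map_eq_zero]
    intro v hv
    have := hTge v
    rw [hv, inner_zero_left] at this
    have h0 : ‖v‖ ^ 2 ≤ 0 := by nlinarith [sq_nonneg ‖v‖]
    simpa using le_antisymm h0 (sq_nonneg _)
  -- x is the coefficient of the regression of D on w; thus η = ⟨q, T⁻¹q⟩ and ρ = ⟨r, T⁻¹q⟩ below.
  obtain ⟨x, hx⟩ := (LinearMap.injective_iff_surjective.1 hTinj) q
  have hxq : ‖x‖ ≤ ‖q‖ / c := by
    rw [le_div_iff₀ hc]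
    have h := (hTge x).trans (real_inner_le_norm _ _)
    rw [hx] at h
    -- The case x = 0 is separate because the bound comes from cancelling one factor ‖x‖.
    rcases (norm_nonneg x).eq_or_lt with h0 | h0
    · rw [← h0]; simp
    · nlinarith
  refine ⟨inner ℝ q x, inner ℝ r x, ?_, ?_, ?_⟩
  · refine (abs_real_inner_le_norm _ _).trans ?_
    calc ‖q‖ * ‖x‖ ≤ ‖q‖ * (‖q‖ / c) := mul_le_mul_of_nonneg_left hxq (norm_nonneg _)
      _ = ‖q‖ ^ 2 / c := by ring
  · refine (abs_real_inner_le_norm _ _).trans ?_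
    calc ‖r‖ * ‖x‖ ≤ ‖r‖ * (‖q‖ / c) := mul_le_mul_of_nonneg_left hxq (norm_nonneg _)
      _ = ‖q‖ * ‖r‖ / c := by ring
  · have hqg : inner ℝ q g = n⁻¹ * ∑ u, D u * inner ℝ (w u) g := by
      simp [hq, inner_smul_left, sum_inner]
    have hqx : inner ℝ q x = n⁻¹ * ∑ u, D u * inner ℝ (w u) x := by
      simp [hq, inner_smul_left, sum_inner]
    have hrx : inner ℝ r x = n⁻¹ * ∑ u, e u * inner ℝ (w u) x := by
      simp [hr, inner_smul_left, sum_inner]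
    have hqg' : inner ℝ q g = n⁻¹ * ∑ u, inner ℝ (w u) x * inner ℝ (w u) g := by
      rw [← hx, hTapp]
    have e1 : n⁻¹ * ∑ u, D u ^ 2 * b + inner ℝ q g - n⁻¹ * ∑ u, D u * e u = 0 := by
      rw [hqg, ← mul_add, ← mul_sub, ← Finset.sum_add_distrib, ← Finset.sum_sub_distrib]
      rw [← mul_zero n⁻¹, ← h1]
      congr 1
      exact Finset.sum_congr rfl fun u _ => by ring
    -- Pairing the control equations with x and using T x = q leaves the unknown g only through ⟨q,
    -- g⟩, which cancels against `e1`.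
    have e2 : inner ℝ q x * b + inner ℝ q g - inner ℝ r x = 0 := by
      have h3 := congrArg (fun z => inner ℝ z x) h2
      simp only [sum_inner, inner_smul_left, conj_trivial, inner_zero_left] at h3
      rw [hqg', hqx, hrx, mul_assoc, Finset.sum_mul, ← mul_add, ← mul_sub,
        ← Finset.sum_add_distrib, ← Finset.sum_sub_distrib, ← mul_zero n⁻¹, ← h3]
      congr 1
      exact Finset.sum_congr rfl fun u _ => by ring
    rw [← Finset.sum_mul] at e1
    linear_combination e1 - e2

end LeastSquares

/-! ### Normal equations of a grouped sample. -/

namespace GroupSample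

variable {Ω : Type*} [MeasurableSpace Ω] {L p : ℕ} (S : GroupSample Ω L p)

/-- The normalized cross moments of the centered regressor and the controls. -/
noncomputable def crossDW (ω : Ω) : EuclideanSpace ℝ (Fin (p + 1)) :=
  S.n⁻¹ • ∑ j, ∑ i, (S.d j ω - S.muD) • S.w j i ω

/-- The normalized cross moments of the controls and the errors. -/
noncomputable def crossWEps (ω : Ω) : EuclideanSpace ℝ (Fin (p + 1)) :=
  S.n⁻¹ • ∑ j, ∑ i, S.eps j i ω • S.w j i ω

/-- The second empirical moment of the centered regressor. -/
noncomputable def sqD (ω : Ω) : ℝ := S.n⁻¹ * ∑ j, (S.size j : ℝ) * (S.d j ω - S.muD) ^ 2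

lemma gramW_isHermitian (ω : Ω) : (S.gramW ω).IsHermitian := by
  ext a b
  simp [gramW, Matrix.sum_apply, Matrix.vecMulVec_apply, mul_comm]

lemma gramW_quadratic (ω : Ω) (v : EuclideanSpace ℝ (Fin (p + 1))) :
    v.ofLp ⬝ᵥ (S.gramW ω *ᵥ v.ofLp)
      = S.n⁻¹ * ∑ u : S.Units, inner ℝ (S.w u.1 u.2 ω) v ^ 2 := by
  rw [gramW, Matrix.smul_mulVec, dotProduct_smul, smul_eq_mul, Fintype.sum_sigma]
  congr 1
  simp only [Matrix.sum_mulVec, dotProduct_sum]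
  refine Finset.sum_congr rfl fun j _ => Finset.sum_congr rfl fun i _ => ?_
  rw [Matrix.vecMulVec_mulVec, dotProduct_smul, EuclideanSpace.inner_eq_star_dotProduct]
  simp [sq, dotProduct_comm]

/-- The normal equations in terms of residuals. -/
lemma transpose_X_mulVec_eq_zero_iff (ω : Ω) (z : S.Units → ℝ) :
    (S.X ω)ᵀ *ᵥ z = 0 ↔
      ∑ u : S.Units, S.d u.1 ω * z u = 0 ∧ ∑ u : S.Units, z u • S.w u.1 u.2 ω = 0 := by
  constructor
  · intro h
    refine ⟨?_, ?_⟩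
    · simpa [Matrix.mulVec, dotProduct, X] using congrFun h (Sum.inl ())
    · ext c
      simpa [Matrix.mulVec, dotProduct, X, mul_comm] using congrFun h (Sum.inr c)
  · rintro ⟨h1, h2⟩
    ext (a | c)
    · simpa [Matrix.mulVec, dotProduct, X] using h1
    · have := congrArg (fun v : EuclideanSpace ℝ (Fin (p + 1)) => v c) h2
      simpa [Matrix.mulVec, dotProduct, X, mul_comm] using this

lemma X_mulVec (ω : Ω) (t : Unit ⊕ Fin (p + 1) → ℝ) (u : S.Units) :
    (S.X ω *ᵥ t) u = S.d u.1 ω * t (Sum.inl ())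
      + inner ℝ (S.w u.1 u.2 ω) (WithLp.toLp 2 fun c => t (Sum.inr c)) := by
  simp [Matrix.mulVec, dotProduct, X, EuclideanSpace.inner_eq_star_dotProduct, mul_comm]

/-- Solutions of the normal equations for an arbitrary left-hand side `e`, after centering the
regressor and partialling out the controls. -/
lemma exists_centered_partial_out {ω : Ω} {c c₀ : ℝ} (hc : 0 < c)
    (hG : ∀ v, c * ‖v‖ ^ 2 ≤ S.n⁻¹ * ∑ u : S.Units, inner ℝ (S.w u.1 u.2 ω) v ^ 2)
    (hc₀ : c₀ ≠ 0) (hw : ∀ j i, S.w j i ω 0 = c₀) (e : S.Units → ℝ)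
    (b : ℝ) (g : EuclideanSpace ℝ (Fin (p + 1)))
    (h : (S.X ω)ᵀ *ᵥ (fun u => S.d u.1 ω * b + inner ℝ (S.w u.1 u.2 ω) g - e u) = 0) :
    ∃ η ρ : ℝ, |η| ≤ ‖S.crossDW ω‖ ^ 2 / c ∧
      |ρ| ≤ ‖S.crossDW ω‖ * ‖S.n⁻¹ • ∑ u : S.Units, e u • S.w u.1 u.2 ω‖ / c ∧
      b * (S.sqD ω - η) = S.n⁻¹ * ∑ u : S.Units, (S.d u.1 ω - S.muD) * e u - ρ := by
  obtain ⟨h1, h2⟩ := (S.transpose_X_mulVec_eq_zero_iff ω _).1 h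
  -- The intercept row of the normal equations: the residuals sum to zero.
  have h0 : ∑ u : S.Units, (S.d u.1 ω * b + inner ℝ (S.w u.1 u.2 ω) g - e u) = 0 := by
    have := congrArg (fun v : EuclideanSpace ℝ (Fin (p + 1)) => v 0) h2
    simp only [WithLp.ofLp_sum, WithLp.ofLp_smul, Finset.sum_apply, Pi.smul_apply, smul_eq_mul, hw,
      ← Finset.sum_mul, WithLp.ofLp_zero, Pi.zero_apply] at this
    exact (mul_eq_zero.1 this).resolve_right hc₀
  -- Centering the regressor changes only the intercept coefficient, by b μ_d / c₀.
  set g' : EuclideanSpace ℝ (Fin (p + 1)) :=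
    g + EuclideanSpace.single 0 (b * S.muD / c₀) with hg'
  have hres : ∀ u : S.Units, (S.d u.1 ω - S.muD) * b + inner ℝ (S.w u.1 u.2 ω) g' - e u
      = S.d u.1 ω * b + inner ℝ (S.w u.1 u.2 ω) g - e u := by
    intro u
    rw [hg', inner_add_right, EuclideanSpace.inner_single_right]
    simp only [conj_trivial, hw]
    field_simp
    ring
  have := exists_partial_out hc (fun u : S.Units => S.d u.1 ω - S.muD) e
    (fun u : S.Units => S.w u.1 u.2 ω) hG b g' ?_ ?_
  · obtain ⟨η, ρ, hη, hρ, heq⟩ := this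
    have hq : S.crossDW ω
        = S.n⁻¹ • ∑ u : S.Units, (S.d u.1 ω - S.muD) • S.w u.1 u.2 ω := by
      rw [crossDW, Fintype.sum_sigma]
    have hD : S.sqD ω = S.n⁻¹ * ∑ u : S.Units, (S.d u.1 ω - S.muD) ^ 2 := by
      rw [sqD, Fintype.sum_sigma]
      simp
    rw [hq, hD]
    exact ⟨η, ρ, hη, hρ, heq⟩
  · have hdiff := Finset.sum_sub_distrib (s := Finset.univ)
      (fun u : S.Units => S.d u.1 ω * (S.d u.1 ω * b + inner ℝ (S.w u.1 u.2 ω) g - e u))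
      (fun u : S.Units => S.muD * (S.d u.1 ω * b + inner ℝ (S.w u.1 u.2 ω) g - e u))
    rw [h1, ← Finset.mul_sum, h0, mul_zero, sub_zero] at hdiff
    rw [← hdiff]
    exact Finset.sum_congr rfl fun u _ => by rw [hres, sub_mul]
  · simp only [hres, h2]

/-- The Gram matrix of the regressors is invertible, and the error of `β̂` is that of the
regression on the centered regressor alone up to terms controlled by the cross moments. -/
lemma exists_betaHat_sub_mul {ω : Ω} {c c₀ : ℝ} (hc : 0 < c)
    (hlam : c ≤ lambdaMin (S.gramW ω)) (hc₀ : c₀ ≠ 0) (hw : ∀ j i, S.w j i ω 0 = c₀)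
    (hden : ‖S.crossDW ω‖ ^ 2 / c < S.sqD ω) :
    ∃ η ρ : ℝ, |η| ≤ ‖S.crossDW ω‖ ^ 2 / c ∧ |ρ| ≤ ‖S.crossDW ω‖ * ‖S.crossWEps ω‖ / c ∧
      √S.n * ((S.betaHat ω - S.β) * (S.sqD ω - η)) = S.score ω - √S.n * ρ := by
  have hG : ∀ v, c * ‖v‖ ^ 2 ≤ S.n⁻¹ * ∑ u : S.Units, inner ℝ (S.w u.1 u.2 ω) v ^ 2 := by
    intro v
    rw [← S.gramW_quadratic]
    exact (mul_le_mul_of_nonneg_right hlam (sq_nonneg _)).trans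
      (lambdaMin_mul_norm_sq_le (S.gramW_isHermitian ω) v)
  -- A kernel vector solves the normal equations with zero left-hand side. The positive denominator
  -- kills its d-component, and coercivity of the control Gram matrix kills the rest.
  have hunit : IsUnit ((S.X ω)ᵀ * S.X ω) := by
    rw [← Matrix.mulVec_injective_iff_isUnit, ← Matrix.coe_mulVecLin, injective_iff_map_eq_zero]
    intro t ht
    rw [Matrix.mulVecLin_apply, ← Matrix.mulVec_mulVec] at ht
    have hXt : S.X ω *ᵥ t = fun u => S.d u.1 ω * t (Sum.inl ())
      + inner ℝ (S.w u.1 u.2 ω) (WithLp.toLp 2 fun c => t (Sum.inr c)) - (fun _ => (0 : ℝ)) u := by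
      ext u
      rw [S.X_mulVec, sub_zero]
    obtain ⟨η, ρ, hη, hρ, heq⟩ := S.exists_centered_partial_out hc hG hc₀ hw (fun _ => 0)
      (t (Sum.inl ())) (WithLp.toLp 2 fun c => t (Sum.inr c)) (by rw [← hXt, ht])
    have hρ0 : ρ = 0 := by simpa using hρ
    have hne : S.sqD ω - η ≠ 0 := by
      have := le_abs_self η
      exact (by linarith : 0 < S.sqD ω - η).ne'
    have hb : t (Sum.inl ()) = 0 := by
      rw [hρ0] at heq
      simpa [hne] using heq
    have hXX : S.X ω *ᵥ t = 0 := by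
      have : (S.X ω *ᵥ t) ⬝ᵥ (S.X ω *ᵥ t) = 0 := by
        rw [Matrix.dotProduct_mulVec, ← Matrix.mulVec_transpose, ht, zero_dotProduct]
      exact dotProduct_self_eq_zero.1 this
    have hgam := hG (WithLp.toLp 2 fun c => t (Sum.inr c))
    have hzero : ∀ u : S.Units,
        inner ℝ (S.w u.1 u.2 ω) (WithLp.toLp 2 fun c => t (Sum.inr c)) = 0 := by
      intro u
      have := congrFun hXX u
      rwa [S.X_mulVec, hb, mul_zero, zero_add] at this
    simp only [hzero] at hgam
    have hnorm : ‖(WithLp.toLp 2 fun c => t (Sum.inr c) : EuclideanSpace ℝ (Fin (p + 1)))‖ ^ 2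
        ≤ 0 := by
      norm_num at hgam
      nlinarith
    have hv : (WithLp.toLp 2 fun c => t (Sum.inr c) : EuclideanSpace ℝ (Fin (p + 1))) = 0 := by
      simpa using le_antisymm hnorm (sq_nonneg _)
    ext (a | c)
    · exact hb
    · exact congrArg (fun v : EuclideanSpace ℝ (Fin (p + 1)) => v c) hv
  have hnormal : (S.X ω)ᵀ *ᵥ (S.X ω *ᵥ S.thetaHat ω - S.Y ω) = 0 := by
    rw [Matrix.mulVec_sub, Matrix.mulVec_mulVec, thetaHat, Matrix.mulVec_mulVec,
      Matrix.mul_nonsing_inv _ ((Matrix.isUnit_iff_isUnit_det _).1 hunit), Matrix.one_mulVec,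
      sub_self]
  have hres : S.X ω *ᵥ S.thetaHat ω - S.Y ω = fun u => S.d u.1 ω * (S.betaHat ω - S.β)
      + inner ℝ (S.w u.1 u.2 ω) ((WithLp.toLp 2 fun c => S.thetaHat ω (Sum.inr c)) - S.γ)
      - S.eps u.1 u.2 ω := by
    ext u
    rw [Pi.sub_apply, S.X_mulVec, Y, y, inner_sub_right, betaHat]
    ring
  rw [hres] at hnormal
  obtain ⟨η, ρ, hη, hρ, heq⟩ := S.exists_centered_partial_out hc hG hc₀ hw
    (fun u => S.eps u.1 u.2 ω) _ _ hnormal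
  refine ⟨η, ρ, hη, ?_, ?_⟩
  · rw [crossWEps, ← Fintype.sum_sigma (fun u : S.Units => S.eps u.1 u.2 ω • S.w u.1 u.2 ω)]
    exact hρ
  · rw [heq, mul_sub, score, Fintype.sum_sigma, ← mul_assoc]
    congr 2
    · rw [← div_eq_mul_inv, Real.sqrt_div_self', one_div]
    · simp [epsSum, Finset.mul_sum]

end GroupSample

/-! ### Second moments of weighted independent sums. -/

lemma sq_integral_le_integral_sq {α : Type*} [MeasurableSpace α] {ν : Measure α}
    [IsProbabilityMeasure ν] {f : α → ℝ} (hf : MemLp f 2 ν) :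
    (∫ x, f x ∂ν) ^ 2 ≤ ∫ x, f x ^ 2 ∂ν := by
  have h := variance_nonneg f ν
  rw [variance_eq_sub hf] at h
  simpa using h

lemma memLp_sq_of_memLp_four {α : Type*} [MeasurableSpace α] {ν : Measure α} {f : α → ℝ}
    (hf : MemLp f 4 ν) : MemLp (fun x => f x ^ 2) 2 ν := by
  have : ENNReal.HolderTriple 4 4 2 := ⟨by
    rw [← two_mul, show (4 : ENNReal) = 2 * 2 by norm_num, ENNReal.mul_inv (by simp) (by simp),
      ← mul_assoc, ENNReal.mul_inv_cancel (by simp) (by simp), one_mul]⟩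
  simpa only [sq] using! hf.mul hf (r := 2)

lemma integrable_pow_four {α : Type*} [MeasurableSpace α] {ν : Measure α} {f : α → ℝ}
    (hf : MemLp f 4 ν) : Integrable (fun x => f x ^ 4) ν := by
  have h := (memLp_sq_of_memLp_four hf).integrable_sq
  simpa [← pow_mul] using h

/-- The second moment of a sum of centered independent variables with independent weights. -/
lemma integral_sq_sum_mul {Ω J : Type*} [MeasurableSpace Ω] [Fintype J] {P : Measure Ω}
    [IsProbabilityMeasure P] {ν : Measure ℝ} {d : J → Ω → ℝ} {W : J → Ω → ℝ} {f : ℝ → ℝ}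
    (hd : ∀ j, HasLaw (d j) ν P) (hdi : iIndepFun d P) (hW : ∀ j, MemLp (W j) 2 P)
    (hdW : IndepFun (fun ω j => d j ω) (fun ω j => W j ω) P) (hf : Measurable f)
    (hf2 : MemLp f 2 ν) (hf0 : ∫ x, f x ∂ν = 0) :
    Integrable (fun ω => (∑ j, f (d j ω) * W j ω) ^ 2) P ∧
      ∫ ω, (∑ j, f (d j ω) * W j ω) ^ 2 ∂P = (∫ x, f x ^ 2 ∂ν) * ∑ j, ∫ ω, W j ω ^ 2 ∂P := by
  classical
  have hfd : ∀ j, MemLp (fun ω => f (d j ω)) 2 P := fun j =>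
    ((hd j).map_eq ▸ hf2).comp_of_map (hd j).aemeasurable
  -- Products over pairs of groups remain independent, so every term of the double sum factors; off
  -- the diagonal the factor coming from d vanishes.
  have hindep : ∀ j k,
      IndepFun (fun ω => f (d j ω) * f (d k ω)) (fun ω => W j ω * W k ω) P := fun j k =>
    hdW.comp (φ := fun x : J → ℝ => f (x j) * f (x k)) (ψ := fun y : J → ℝ => y j * y k)
      (by fun_prop) (by fun_prop)
  have hint : ∀ j k, Integrable (fun ω => (f (d j ω) * f (d k ω)) * (W j ω * W k ω)) P :=
    fun j k => (hindep j k).integrable_mul ((hfd j).integrable_mul (hfd k))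
      ((hW j).integrable_mul (hW k))
  have hexp : ∀ ω, (∑ j, f (d j ω) * W j ω) ^ 2
      = ∑ j, ∑ k, (f (d j ω) * f (d k ω)) * (W j ω * W k ω) := fun ω => by
    rw [sq, Finset.sum_mul_sum]
    exact Finset.sum_congr rfl fun j _ => Finset.sum_congr rfl fun k _ => by ring
  have hmean : ∀ j, ∫ ω, f (d j ω) ∂P = 0 := fun j => by
    rw [← hf0]
    exact (hd j).integral_comp hf.aestronglyMeasurable
  have hcross : ∀ j k, j ≠ k → ∫ ω, f (d j ω) * f (d k ω) ∂P = 0 := fun j k hjk => by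
    have h := ((hdi.indepFun hjk).comp hf hf).integral_mul_eq_mul_integral
      (hfd j).aestronglyMeasurable (hfd k).aestronglyMeasurable
    change ∫ ω, f (d j ω) * f (d k ω) ∂P = (∫ ω, f (d j ω) ∂P) * ∫ ω, f (d k ω) ∂P at h
    rw [h, hmean, zero_mul]
  have hterm : ∀ j k, ∫ ω, (f (d j ω) * f (d k ω)) * (W j ω * W k ω) ∂P
      = (∫ ω, f (d j ω) * f (d k ω) ∂P) * ∫ ω, W j ω * W k ω ∂P := fun j k =>
    (hindep j k).integral_mul_eq_mul_integral
      ((hfd j).integrable_mul (hfd k)).aestronglyMeasurable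
      ((hW j).integrable_mul (hW k)).aestronglyMeasurable
  simp_rw [hexp]
  refine ⟨integrable_finsetSum _ fun j _ => integrable_finsetSum _ fun k _ => hint j k, ?_⟩
  rw [integral_finsetSum _ fun j _ => integrable_finsetSum _ fun k _ => hint j k, Finset.mul_sum]
  refine Finset.sum_congr rfl fun j _ => ?_
  rw [integral_finsetSum _ fun k _ => hint j k, Finset.sum_eq_single j]
  · rw [hterm]
    congr 1
    · rw [← (hd j).integral_comp (hf.pow_const 2).aestronglyMeasurable]
      simp [sq]
    · simp [sq]
  · intro k _ hk
    rw [hterm, hcross j k hk.symm, zero_mul]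
  · simp

/-! ### Moment bounds for the regressor and the cross moments. -/

namespace GroupSample

variable {Ω : Type*} [MeasurableSpace Ω] {L p : ℕ} {S : GroupSample Ω L p} {P : Measure Ω}
  {K : ℝ}

lemma RegressorCond.memLp_id (h : S.RegressorCond P K) (j : Fin S.numGroups) :
    MemLp (fun x : ℝ => x) 4 S.law := by
  rw [← (h.hasLaw j).map_eq, memLp_map_measure_iff (by fun_prop) (h.hasLaw j).aemeasurable]
  exact h.memLp_d j

lemma RegressorCond.integral_pow_four_le (h : S.RegressorCond P K) (j : Fin S.numGroups) :
    ∫ x, x ^ 4 ∂S.law ≤ K := by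
  have h1 := h.moment_d j
  rw [← (h.hasLaw j).integral_comp (f := fun x : ℝ => x ^ 4) (by fun_prop)]
  simpa [Even.pow_abs (by decide : Even 4)] using h1

variable [IsProbabilityMeasure P]

lemma RegressorCond.isProbabilityMeasure_law (h : S.RegressorCond P K) (j : Fin S.numGroups) :
    IsProbabilityMeasure S.law :=
  (h.hasLaw j).map_eq ▸ Measure.isProbabilityMeasure_map (h.hasLaw j).aemeasurable

lemma RegressorCond.memLp_center (h : S.RegressorCond P K) (j : Fin S.numGroups) :
    MemLp (fun x : ℝ => x - S.muD) 4 S.law :=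
  have := h.isProbabilityMeasure_law j
  (h.memLp_id j).sub (memLp_const _)

/-- Jensen used twice gives μ_d⁴ ≤ E d⁴, and (x - μ)⁴ ≤ 8x⁴ + 8μ⁴; hence 16 = 8 + 8. -/
lemma RegressorCond.integral_center_pow_four_le (h : S.RegressorCond P K)
    (j : Fin S.numGroups) : ∫ x, (x - S.muD) ^ 4 ∂S.law ≤ 16 * K := by
  have := h.isProbabilityMeasure_law j
  have hid := h.memLp_id j
  have hmu : S.muD ^ 4 ≤ ∫ x, x ^ 4 ∂S.law := by
    have h1 : S.muD ^ 2 ≤ ∫ x, x ^ 2 ∂S.law :=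
      sq_integral_le_integral_sq (hid.mono_exponent (by norm_num))
    have h2 := sq_integral_le_integral_sq (memLp_sq_of_memLp_four hid)
    simp only [← pow_mul] at h2
    nlinarith [sq_nonneg S.muD]
  have hK := h.integral_pow_four_le j
  calc ∫ x, (x - S.muD) ^ 4 ∂S.law
      ≤ ∫ x, (8 * x ^ 4 + 8 * S.muD ^ 4) ∂S.law := by
        refine integral_mono (integrable_pow_four (h.memLp_center j))
          (((integrable_pow_four hid).const_mul 8).add (integrable_const _)) fun x => ?_
        change (x - S.muD) ^ 4 ≤ 8 * x ^ 4 + 8 * S.muD ^ 4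
        nlinarith [sq_nonneg (x + S.muD), sq_nonneg (x ^ 2 - S.muD ^ 2),
          sq_nonneg ((x + S.muD) ^ 2), sq_nonneg ((x + S.muD) * (x - S.muD)),
          mul_nonneg (sq_nonneg (x + S.muD)) (sq_nonneg (x - S.muD))]
    _ = 8 * ∫ x, x ^ 4 ∂S.law + 8 * S.muD ^ 4 := by
        rw [integral_add ((integrable_pow_four hid).const_mul 8) (integrable_const _),
          integral_const_mul]
        simp
    _ ≤ 16 * K := by linarith

lemma RegressorCond.integral_center_eq_zero (h : S.RegressorCond P K) (j : Fin S.numGroups) :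
    ∫ x, (x - S.muD) ∂S.law = 0 := by
  have := h.isProbabilityMeasure_law j
  rw [integral_sub ((h.memLp_id j).integrable (by norm_num)) (integrable_const _)]
  simp [muD]

/-- Jensen bounds the squared variance by the fourth central moment, and v ≤ 1 + v² avoids a square
root in the constant. -/
lemma RegressorCond.varD_le (h : S.RegressorCond P K) (j : Fin S.numGroups) :
    S.varD ≤ 1 + 16 * K := by
  have := h.isProbabilityMeasure_law j
  have h4 := h.integral_center_pow_four_le j
  have h2 := sq_integral_le_integral_sq (memLp_sq_of_memLp_four (h.memLp_center j))
  simp only [← pow_mul] at h2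
  have h3 : S.varD ^ 2 ≤ 16 * K := le_trans h2 h4
  nlinarith [sq_nonneg (S.varD - 1)]

lemma sum_size_eq (S : GroupSample Ω L p) : ∑ j, (S.size j : ℝ) = S.n := by
  simp [n]

lemma sum_size_sq_eq (S : GroupSample Ω L p) : ∑ j, (S.size j : ℝ) ^ 2 = S.kappa ^ 2 := by
  rw [kappa, Real.sq_sqrt (by positivity)]

/-- The cross moments of the centered regressor and the controls are of order `κ / n`. -/
lemma RegressorCond.integral_crossDW_sq_le (h : S.RegressorCond P K) (j₀ : Fin S.numGroups)
    (hw : ∀ j i, MemLp (S.w j i) 2 P) (hwK : ∀ j i, ∫ ω, ‖S.w j i ω‖ ^ 2 ∂P ≤ K)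
    (a : Fin (p + 1)) :
    Integrable (fun ω => S.crossDW ω a ^ 2) P ∧
      ∫ ω, S.crossDW ω a ^ 2 ∂P ≤ (1 + 16 * K) * K * (S.kappa / S.n) ^ 2 := by
  have hprob := h.isProbabilityMeasure_law j₀
  have hwa : ∀ j i, MemLp (fun ω => S.w j i ω a) 2 P := fun j i =>
    (hw j i).continuousLinearMap_comp (EuclideanSpace.proj a : _ →L[ℝ] ℝ)
  have hW : ∀ j, MemLp (fun ω => ∑ i, S.w j i ω a) 2 P := fun j =>
    memLp_finsetSum _ fun i _ => hwa j i
  -- Cauchy–Schwarz within a group costs a factor n_j; the resulting sum of n_j² is what produces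
  -- κ².
  have hWK : ∀ j, ∫ ω, (∑ i, S.w j i ω a) ^ 2 ∂P ≤ (S.size j : ℝ) ^ 2 * K := by
    intro j
    calc ∫ ω, (∑ i, S.w j i ω a) ^ 2 ∂P
        ≤ ∫ ω, (S.size j : ℝ) * ∑ i, S.w j i ω a ^ 2 ∂P := by
          refine integral_mono (hW j).integrable_sq
            ((integrable_finsetSum _ fun i _ => (hwa j i).integrable_sq).const_mul _) fun ω => ?_
          simpa using sq_sum_le_card_mul_sum_sq (s := Finset.univ) (f := fun i => S.w j i ω a)
      _ = (S.size j : ℝ) * ∑ i, ∫ ω, S.w j i ω a ^ 2 ∂P := by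
          rw [integral_const_mul, integral_finsetSum _ fun i _ => (hwa j i).integrable_sq]
      _ ≤ (S.size j : ℝ) * ∑ _i : Fin (S.size j), K := by
          gcongr with i
          refine le_trans (integral_mono (hwa j i).integrable_sq (hw j i).norm.integrable_sq
            fun ω => ?_) (hwK j i)
          have := PiLp.norm_apply_le (S.w j i ω) a
          rw [Real.norm_eq_abs] at this
          exact sq_le_sq.2 (by rwa [abs_norm])
      _ = (S.size j : ℝ) ^ 2 * K := by
          simp
          ring
  have hdW : IndepFun (fun ω j => S.d j ω) (fun ω j => ∑ i, S.w j i ω a) P :=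
    h.indep_w.comp (φ := fun x : Fin S.numGroups → ℝ => x)
      (ψ := fun y : (j : Fin S.numGroups) → Fin (S.size j) → EuclideanSpace ℝ (Fin (p + 1)) =>
        fun j => ∑ i, y j i a) measurable_id (by fun_prop)
  obtain ⟨hint, heq⟩ := integral_sq_sum_mul h.hasLaw h.indep hW hdW
    (f := fun x => x - S.muD) (by fun_prop)
    ((h.memLp_center j₀).mono_exponent (by norm_num)) (h.integral_center_eq_zero j₀)
  have hq : ∀ ω, S.crossDW ω a ^ 2
      = S.n⁻¹ ^ 2 * (∑ j, (S.d j ω - S.muD) * ∑ i, S.w j i ω a) ^ 2 := fun ω => by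
    rw [← mul_pow]
    simp [crossDW, Finset.mul_sum]
  simp_rw [hq]
  refine ⟨hint.const_mul _, ?_⟩
  have hv0 : 0 ≤ S.varD := integral_nonneg fun x => sq_nonneg _
  have hK0 : 0 ≤ K := (integral_nonneg fun x => by positivity).trans (h.moment_d j₀)
  rw [integral_const_mul, heq]
  change S.n⁻¹ ^ 2 * (S.varD * _) ≤ _
  calc S.n⁻¹ ^ 2 * (S.varD * ∑ j, ∫ ω, (∑ i, S.w j i ω a) ^ 2 ∂P)
      ≤ S.n⁻¹ ^ 2 * ((1 + 16 * K) * ∑ j, (S.size j : ℝ) ^ 2 * K) := by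
        refine mul_le_mul_of_nonneg_left ?_ (sq_nonneg _)
        exact mul_le_mul (h.varD_le j₀) (Finset.sum_le_sum fun j _ => hWK j)
          (Finset.sum_nonneg fun j _ => integral_nonneg fun ω => sq_nonneg _) (by positivity)
    _ = (1 + 16 * K) * K * (S.kappa / S.n) ^ 2 := by
        rw [← Finset.sum_mul, sum_size_sq_eq]
        ring

/-- The empirical second moment of the centered regressor concentrates around its variance. -/
lemma RegressorCond.integral_sqD_sub_sq_le (h : S.RegressorCond P K) (j₀ : Fin S.numGroups)
    (hn : S.n ≠ 0) :
    Integrable (fun ω => (S.sqD ω - S.varD) ^ 2) P ∧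
      ∫ ω, (S.sqD ω - S.varD) ^ 2 ∂P ≤ 16 * K * (S.kappa / S.n) ^ 2 := by
  have hprob := h.isProbabilityMeasure_law j₀
  have hf2 : MemLp (fun x : ℝ => (x - S.muD) ^ 2) 2 S.law :=
    memLp_sq_of_memLp_four (h.memLp_center j₀)
  have hf0 : ∫ x, ((x - S.muD) ^ 2 - S.varD) ∂S.law = 0 := by
    rw [integral_sub (hf2.integrable (by norm_num)) (integrable_const _)]
    simp [varD]
  have hvar : ∫ x, ((x - S.muD) ^ 2 - S.varD) ^ 2 ∂S.law ≤ 16 * K := by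
    refine le_trans ?_ (h.integral_center_pow_four_le j₀)
    -- Centering only lowers the second moment of (x - μ_d)².
    have h1 := variance_le_expectation_sq (μ := S.law) hf2.aestronglyMeasurable
    rw [variance_eq_integral hf2.aemeasurable] at h1
    simpa [← pow_mul, varD] using h1
  -- The group sizes act as weights; being constant, they are independent of the regressors.
  obtain ⟨hint, heq⟩ := integral_sq_sum_mul (P := P) (W := fun j _ => (S.size j : ℝ))
    (f := fun x => (x - S.muD) ^ 2 - S.varD) h.hasLaw h.indep (fun j => memLp_const _)
    (indepFun_const_right _ _) (by fun_prop) (hf2.sub (memLp_const _)) hf0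
  have hD : ∀ ω, (S.sqD ω - S.varD) ^ 2
      = S.n⁻¹ ^ 2 * (∑ j, ((S.d j ω - S.muD) ^ 2 - S.varD) * (S.size j : ℝ)) ^ 2 := fun ω => by
    rw [← mul_pow]
    congr 1
    simp only [sub_mul, Finset.sum_sub_distrib, ← Finset.mul_sum, sum_size_eq, sqD, mul_sub]
    rw [mul_left_comm S.n⁻¹ S.varD, inv_mul_cancel₀ hn, mul_one]
    simp only [mul_comm]
  simp_rw [hD]
  refine ⟨hint.const_mul _, ?_⟩
  rw [integral_const_mul, heq]
  simp only [integral_const, probReal_univ, one_smul, sum_size_sq_eq]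
  calc S.n⁻¹ ^ 2 * ((∫ x, ((x - S.muD) ^ 2 - S.varD) ^ 2 ∂S.law) * S.kappa ^ 2)
      ≤ S.n⁻¹ ^ 2 * (16 * K * S.kappa ^ 2) := by gcongr
    _ = 16 * K * (S.kappa / S.n) ^ 2 := by ring

end GroupSample

/-! ### Quantitative Gaussian approximation of characteristic functions. -/

section CharacteristicFunctions

/-- Factors are swapped one at a time while all others have modulus at most 1. This reduces the
Gaussian approximation to one group at a time. -/
lemma norm_prod_sub_prod_le {ι : Type*} (s : Finset ι) {a b : ι → ℂ} (ha : ∀ i ∈ s, ‖a i‖ ≤ 1)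
    (hb : ∀ i ∈ s, ‖b i‖ ≤ 1) : ‖∏ i ∈ s, a i - ∏ i ∈ s, b i‖ ≤ ∑ i ∈ s, ‖a i - b i‖ := by
  classical
  induction s using Finset.induction_on with
  | empty => simp
  | insert i s hi ih =>
    rw [Finset.prod_insert hi, Finset.prod_insert hi, Finset.sum_insert hi]
    have ha' : ‖∏ j ∈ s, a j‖ ≤ 1 := by
      rw [norm_prod]
      exact Finset.prod_le_one (fun _ _ => norm_nonneg _)
        fun j hj => ha j (Finset.mem_insert_of_mem hj)
    calc ‖a i * ∏ j ∈ s, a j - b i * ∏ j ∈ s, b j‖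
        = ‖(a i - b i) * ∏ j ∈ s, a j + b i * (∏ j ∈ s, a j - ∏ j ∈ s, b j)‖ := by
          congr 1; ring
      _ ≤ ‖a i - b i‖ * ‖∏ j ∈ s, a j‖ + ‖b i‖ * ‖∏ j ∈ s, a j - ∏ j ∈ s, b j‖ := by
          refine (norm_add_le _ _).trans ?_
          rw [norm_mul, norm_mul]
      _ ≤ ‖a i - b i‖ * 1 + 1 * ∑ j ∈ s, ‖a j - b j‖ := by
          gcongr
          · exact hb i (Finset.mem_insert_self i s)
          · exact ih (fun j hj => ha j (Finset.mem_insert_of_mem hj))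
              fun j hj => hb j (Finset.mem_insert_of_mem hj)
      _ = _ := by ring

/-- For |y| ≤ 1 this is Taylor's formula with remainder; for |y| ≥ 1 every term is at most a
multiple of |y|³, and 1 + 1 + 1 + 1/2 ≤ 4. -/
lemma norm_exp_mul_I_sub_taylor_le (y : ℝ) :
    ‖Complex.exp (y * Complex.I) - (1 + y * Complex.I - y ^ 2 / 2)‖ ≤ 4 * |y| ^ 3 := by
  rcases le_total |y| 1 with hy | hy
  · have h := Complex.exp_bound (x := y * Complex.I) (n := 3) (by simpa using hy) (by norm_num)
    have hs : ∑ m ∈ Finset.range 3, ((y : ℂ) * Complex.I) ^ m / (m.factorial : ℂ)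
        = 1 + y * Complex.I - y ^ 2 / 2 := by
      simp only [Finset.sum_range_succ, Finset.sum_range_zero, mul_pow, Complex.I_sq]
      simp [Nat.factorial]
      ring
    rw [hs] at h
    refine h.trans ?_
    simp only [norm_mul, Complex.norm_real, Complex.norm_I, mul_one, Real.norm_eq_abs]
    rw [mul_comm]
    refine mul_le_mul_of_nonneg_right ?_ (by positivity)
    norm_num [Nat.factorial]
  · have h1 : ‖Complex.exp (y * Complex.I)‖ = 1 := Complex.norm_exp_ofReal_mul_I y
    calc ‖Complex.exp (y * Complex.I) - (1 + y * Complex.I - y ^ 2 / 2)‖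
        ≤ ‖Complex.exp (y * Complex.I)‖ + (‖(1 : ℂ)‖ + ‖(y : ℂ) * Complex.I‖ + ‖(y : ℂ) ^ 2 / 2‖) :=
          (norm_sub_le _ _).trans (add_le_add le_rfl ((norm_sub_le _ _).trans
            (add_le_add (norm_add_le _ _) le_rfl)))
      _ = 2 + |y| + |y| ^ 2 / 2 := by
          rw [h1]
          simp only [norm_mul, norm_div, norm_pow, Complex.norm_real, Complex.norm_I,
            Real.norm_eq_abs, norm_one]
          norm_num
          ring
      _ ≤ 4 * |y| ^ 3 := by
          have h2 : |y| ^ 2 ≤ |y| ^ 3 := pow_le_pow_right₀ hy (by norm_num)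
          have h3 : |y| ≤ |y| ^ 2 := by nlinarith
          linarith

lemma abs_exp_neg_sub_one_add_le {s : ℝ} (hs : 0 ≤ s) : |Real.exp (-s) - (1 - s)| ≤ s ^ 2 := by
  rcases le_total s 1 with h | h
  · have := Real.abs_exp_sub_one_sub_id_le (x := -s) (by rwa [abs_neg, abs_of_nonneg hs])
    rw [neg_sq] at this
    convert this using 2
    ring
  · have h1 := Real.add_one_le_exp (-s)
    have h2 : Real.exp (-s) ≤ 1 := Real.exp_le_one_iff.2 (by linarith)
    rw [abs_le]
    constructor <;> nlinarith

variable {E : Type*} [NormedAddCommGroup E] [InnerProductSpace ℝ E] [MeasurableSpace E]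

/-- Distance of a characteristic function from the Gaussian one with the same variance. -/
lemma norm_charFun_sub_gaussian_le {ν : Measure E} [IsProbabilityMeasure ν] {y : E}
    (hm : MemLp (fun b => inner ℝ b y) 4 ν) (h0 : ∫ b, inner ℝ b y ∂ν = 0) {η : ℝ} (hη : 0 < η) :
    ‖charFun ν y - (Real.exp (-(∫ b, inner ℝ b y ^ 2 ∂ν) / 2) : ℝ)‖
      ≤ 2 * η * ∫ b, inner ℝ b y ^ 2 ∂ν + (2 / η + 1) * ∫ b, inner ℝ b y ^ 4 ∂ν := by
  have hi1 : Integrable (fun b => inner ℝ b y) ν := hm.integrable (by norm_num)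
  have hi2 : Integrable (fun b => inner ℝ b y ^ 2) ν :=
    (hm.mono_exponent (by norm_num : (2 : ENNReal) ≤ 4)).integrable_sq
  have hi4 : Integrable (fun b => inner ℝ b y ^ 4) ν := integrable_pow_four hm
  set v := ∫ b, inner ℝ b y ^ 2 ∂ν with hv
  set m := ∫ b, inner ℝ b y ^ 4 ∂ν with hm4
  have hv0 : 0 ≤ v := integral_nonneg fun b => sq_nonneg _
  have hvm : v ^ 2 ≤ m := by
    have := sq_integral_le_integral_sq (memLp_sq_of_memLp_four hm)
    simpa [← pow_mul] using this
  have hexp : Integrable (fun b => Complex.exp ((inner ℝ b y : ℝ) * Complex.I)) ν := by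
    refine Integrable.of_bound ?_ 1 (ae_of_all _ fun b => (Complex.norm_exp_ofReal_mul_I _).le)
    exact (Complex.measurable_ofReal.comp_aemeasurable hi1.aemeasurable
      |>.mul_const _ |> Complex.measurable_exp.comp_aemeasurable).aestronglyMeasurable
  have htay : Integrable (fun b => (1 + (inner ℝ b y : ℝ) * Complex.I
      - ((inner ℝ b y : ℝ) : ℂ) ^ 2 / 2)) ν := by
    refine ((integrable_const _).add (hi1.ofReal.mul_const _)).sub ?_
    simpa using (hi2.ofReal (𝕜 := ℂ)).div_const 2
  have htayint : ∫ b, (1 + (inner ℝ b y : ℝ) * Complex.I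
      - ((inner ℝ b y : ℝ) : ℂ) ^ 2 / 2) ∂ν = ((1 - v / 2 : ℝ) : ℂ) := by
    have e1 : ∫ b, ((inner ℝ b y : ℝ) : ℂ) ∂ν = 0 := by
      rw [integral_complex_ofReal, h0, Complex.ofReal_zero]
    have e2 : ∫ b, ((inner ℝ b y : ℝ) : ℂ) ^ 2 ∂ν = (v : ℂ) := by
      rw [hv, ← integral_complex_ofReal]
      simp
    have hi2' : Integrable (fun b => ((inner ℝ b y : ℝ) : ℂ) ^ 2) ν := by
      simpa using (hi2.ofReal (𝕜 := ℂ))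
    have hi1' : Integrable (fun b => 1 + ((inner ℝ b y : ℝ) : ℂ) * Complex.I) ν :=
      (integrable_const _).add (hi1.ofReal.mul_const _)
    rw [integral_sub hi1' (hi2'.div_const 2), integral_add (integrable_const _)
      (hi1.ofReal.mul_const _), integral_mul_const, e1,
      integral_div, e2]
    simp
  have hfirst : ‖charFun ν y - ((1 - v / 2 : ℝ) : ℂ)‖ ≤ 2 * η * v + 2 / η * m := by
    rw [charFun_apply, ← htayint, ← integral_sub hexp htay]
    refine (norm_integral_le_integral_norm _).trans ?_
    have hbound : ∀ b, ‖Complex.exp ((inner ℝ b y : ℝ) * Complex.I)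
        - (1 + (inner ℝ b y : ℝ) * Complex.I - ((inner ℝ b y : ℝ) : ℂ) ^ 2 / 2)‖
        ≤ 2 * η * inner ℝ b y ^ 2 + 2 / η * inner ℝ b y ^ 4 := by
      intro b
      refine (norm_exp_mul_I_sub_taylor_le _).trans ?_
      set z : ℝ := inner ℝ b y
      -- Expanding the square gives 4|z|³ ≤ 2ηz² + (2/η)z⁴: third moments are traded for second and
      -- fourth ones, which are the moments controlled later.
      have hkey : 0 ≤ 2 / η * (z ^ 2 * (η - |z|) ^ 2) := by positivity
      have hz : z ^ 2 = |z| ^ 2 := (sq_abs z).symm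
      have hz4 : z ^ 4 = |z| ^ 4 := by rw [Even.pow_abs (by decide : Even 4)]
      have heq : 2 / η * (z ^ 2 * (η - |z|) ^ 2)
          = 2 * η * z ^ 2 + 2 / η * z ^ 4 - 4 * |z| ^ 3 := by
        rw [hz4, hz]
        field_simp
        ring
      linarith
    refine (integral_mono (hexp.sub htay).norm ((hi2.const_mul _).add (hi4.const_mul _))
      hbound).trans_eq ?_
    simp only [Pi.add_apply]
    rw [integral_add (hi2.const_mul _) (hi4.const_mul _), integral_const_mul, integral_const_mul]
  -- The error is at most (v/2)², and v² ≤ m by Jensen.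
  have hsecond : ‖((1 - v / 2 : ℝ) : ℂ) - (Real.exp (-v / 2) : ℝ)‖ ≤ m := by
    rw [← Complex.ofReal_sub, Complex.norm_real, Real.norm_eq_abs, abs_sub_comm, neg_div]
    refine (abs_exp_neg_sub_one_add_le (by positivity)).trans ?_
    nlinarith [sq_nonneg v]
  calc _ ≤ ‖charFun ν y - ((1 - v / 2 : ℝ) : ℂ)‖
        + ‖((1 - v / 2 : ℝ) : ℂ) - (Real.exp (-v / 2) : ℝ)‖ := norm_sub_le_norm_sub_add_norm_sub _ _ _
    _ ≤ (2 * η * v + 2 / η * m) + m := add_le_add hfirst hsecond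
    _ = _ := by ring

/-- The Lyapunov estimate behind the conditional limit theorem: the total variance carries the small
factor η, while the total fourth moment, with its large factor, will tend to zero for each fixed η.
-/
lemma norm_prod_charFun_sub_gaussian_le {J : Type*} [Fintype J] {ν : Measure E}
    [IsProbabilityMeasure ν] {y : J → E} (hm : ∀ j, MemLp (fun b => inner ℝ b (y j)) 4 ν)
    (h0 : ∀ j, ∫ b, inner ℝ b (y j) ∂ν = 0) {η : ℝ} (hη : 0 < η) :
    ‖∏ j, charFun ν (y j) - (Real.exp (-(∑ j, ∫ b, inner ℝ b (y j) ^ 2 ∂ν) / 2) : ℝ)‖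
      ≤ 2 * η * ∑ j, ∫ b, inner ℝ b (y j) ^ 2 ∂ν
        + (2 / η + 1) * ∑ j, ∫ b, inner ℝ b (y j) ^ 4 ∂ν := by
  have hprod : ((Real.exp (-(∑ j, ∫ b, inner ℝ b (y j) ^ 2 ∂ν) / 2) : ℝ) : ℂ)
      = ∏ j, ((Real.exp (-(∫ b, inner ℝ b (y j) ^ 2 ∂ν) / 2) : ℝ) : ℂ) := by
    rw [← Complex.ofReal_prod, ← Real.exp_sum]
    simp [neg_div, Finset.sum_div]
  rw [hprod, Finset.mul_sum, Finset.mul_sum, ← Finset.sum_add_distrib]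
  refine (norm_prod_sub_prod_le _ (fun j _ => norm_charFun_le_one _) fun j _ => ?_).trans
    (Finset.sum_le_sum fun j _ => norm_charFun_sub_gaussian_le (hm j) (h0 j) hη)
  rw [Complex.norm_real, Real.norm_eq_abs, Real.abs_exp, Real.exp_le_one_iff]
  have : 0 ≤ ∫ b, inner ℝ b (y j) ^ 2 ∂ν := integral_nonneg fun b => sq_nonneg _
  linarith

/-- The characteristic function of a sum of independent variables weighted by an independent
vector, after integrating out the former. -/
lemma integral_exp_sum_inner_mul [BorelSpace E] [SecondCountableTopology E] {Ω J F : Type*} [MeasurableSpace Ω]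
    [MeasurableSpace F] [Fintype J] {P : Measure Ω} [IsProbabilityMeasure P] {ν : Measure E}
    [IsProbabilityMeasure ν] {B : J → Ω → E} {Y : Ω → F} (hB : ∀ j, HasLaw (B j) ν P)
    (hBi : iIndepFun B P) (hY : AEMeasurable Y P) (hBY : IndepFun (fun ω j => B j ω) Y P)
    {y : J → F → E} (hy : ∀ j, Measurable (y j)) {g : F → ℂ} (hg : Measurable g)
    (hg1 : ∀ z, ‖g z‖ ≤ 1) :
    ∫ ω, Complex.exp ((∑ j, inner ℝ (B j ω) (y j (Y ω)) : ℝ) * Complex.I) * g (Y ω) ∂P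
      = ∫ ω, (∏ j, charFun ν (y j (Y ω))) * g (Y ω) ∂P := by
  have hBm : AEMeasurable (fun ω j => B j ω) P :=
    aemeasurable_pi_lambda _ fun j => (hB j).aemeasurable
  have hmap := (indepFun_iff_map_prod_eq_prod_map_map hBm hY).1 hBY
  have hpi := (iIndepFun_iff_map_fun_eq_pi_map fun j => (hB j).aemeasurable).1 hBi
  simp only [fun j => (hB j).map_eq] at hpi
  rw [hpi] at hmap
  have hYprob : IsProbabilityMeasure (P.map Y) := Measure.isProbabilityMeasure_map hY
  let H : (J → E) × F → ℂ := fun z =>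
    Complex.exp ((∑ j, inner ℝ (z.1 j) (y j z.2) : ℝ) * Complex.I) * g z.2
  have hHm : Measurable H := by
    have h1 : Measurable fun z : (J → E) × F => ∑ j, inner ℝ (z.1 j) (y j z.2) :=
      Finset.measurable_fun_sum _ fun j _ =>
        ((measurable_pi_apply j).comp measurable_fst).inner ((hy j).comp measurable_snd)
    exact ((Complex.measurable_ofReal.comp h1).mul_const _).cexp.mul (hg.comp measurable_snd)
  have hHi : Integrable H ((Measure.pi fun _ : J => ν).prod (P.map Y)) := by
    refine Integrable.of_bound hHm.aestronglyMeasurable 1 (ae_of_all _ fun z => ?_)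
    rw [norm_mul, Complex.norm_exp_ofReal_mul_I, one_mul]
    exact hg1 _
  calc ∫ ω, Complex.exp ((∑ j, inner ℝ (B j ω) (y j (Y ω)) : ℝ) * Complex.I) * g (Y ω) ∂P
      = ∫ ω, H ((fun j => B j ω), Y ω) ∂P := rfl
    _ = ∫ z, H z ∂((Measure.pi fun _ : J => ν).prod (P.map Y)) := by
        rw [← hmap, integral_map (hBm.prodMk hY) hHm.aestronglyMeasurable]
    -- Fubini with the weights outermost: for fixed z the integral over the product measure factors
    -- over the groups.
    _ = ∫ z, ∫ b, H (b, z) ∂(Measure.pi fun _ : J => ν) ∂(P.map Y) := integral_prod_symm _ hHi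
    _ = ∫ z, (∏ j, charFun ν (y j z)) * g z ∂(P.map Y) := by
        congr 1
        ext z
        simp only [H]
        rw [integral_mul_const]
        congr 1
        simp only [Complex.ofReal_sum, Finset.sum_mul, Complex.exp_sum]
        rw [integral_fintype_prod_eq_prod
          (fun j (b : E) => Complex.exp ((inner ℝ b (y j z) : ℝ) * Complex.I))]
        simp only [charFun_apply]
    _ = ∫ ω, (∏ j, charFun ν (y j (Y ω))) * g (Y ω) ∂P := by
        rw [integral_map hY]
        refine (Measurable.mul ?_ hg).aestronglyMeasurable
        exact Finset.measurable_fun_prod _ fun j _ => measurable_charFun.comp (hy j)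

end CharacteristicFunctions

/-! ### Decomposition of the score and its conditional variance. -/

namespace GroupSample

variable {Ω : Type*} [MeasurableSpace Ω] {L p : ℕ} {S : GroupSample Ω L p} {P : Measure Ω} {K : ℝ}

/-- The common law of the centered vectors `Aⱼ - μ_A`. -/
noncomputable def scoreLaw (S : GroupSample Ω L p) : Measure (EuclideanSpace ℝ (Fin L)) :=
  S.law.map fun x => S.Afun x - S.muA

/-- The conditional variance of `n^{-1/2} ∑ⱼ (Aⱼ - μ_A)ᵀ ∑ᵢ e_{ij}` given the errors. -/
noncomputable def condVar (S : GroupSample Ω L p) (ω : Ω) : ℝ :=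
  S.n⁻¹ * ∑ j, ∫ b, inner ℝ b (S.eSum j ω) ^ 2 ∂S.scoreLaw

lemma measurable_Afun (hσ : ∀ l, Measurable (S.σ l)) : Measurable S.Afun := by
  unfold Afun
  have := hσ
  fun_prop

/-- Each coordinate contributes at most K² to the squared norm, whence √(L K²). The bound is only
almost sure, since the scale functions are controlled only on values of the regressor. -/
lemma norm_Afun_le (hb : ∀ l, ∀ᵐ x ∂S.law, |S.σ l x| ≤ K) :
    ∀ᵐ x ∂S.law, ‖S.Afun x‖ ≤ √(L * K ^ 2) * ‖x - S.muD‖ := by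
  filter_upwards [ae_all_iff.2 hb] with x hx
  rw [← Real.sqrt_sq (norm_nonneg (x - S.muD)), ← Real.sqrt_mul (by positivity),
    EuclideanSpace.norm_eq]
  refine Real.sqrt_le_sqrt ?_
  calc ∑ l, ‖S.Afun x l‖ ^ 2 ≤ ∑ _l : Fin L, K ^ 2 * ‖x - S.muD‖ ^ 2 := by
        refine Finset.sum_le_sum fun l _ => ?_
        simp only [Afun, norm_mul, mul_pow]
        rw [mul_comm]
        refine mul_le_mul_of_nonneg_right ?_ (sq_nonneg _)
        exact pow_le_pow_left₀ (norm_nonneg _) (hx l) 2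
    _ = L * K ^ 2 * ‖x - S.muD‖ ^ 2 := by
        simp
        ring

lemma hasLaw_A_sub (h : S.RegressorCond P K) (hσ : ∀ l, Measurable (S.σ l))
    (j : Fin S.numGroups) : HasLaw (fun ω => S.A j ω - S.muA) S.scoreLaw P where
  aemeasurable := ((measurable_Afun hσ).sub_const _).comp_aemeasurable (h.hasLaw j).aemeasurable
  map_eq := by
    rw [scoreLaw, ← (h.hasLaw j).map_eq, AEMeasurable.map_map_of_aemeasurable
      ((measurable_Afun hσ).sub_const _).aemeasurable (h.hasLaw j).aemeasurable]
    rfl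

lemma iIndepFun_A_sub (h : S.RegressorCond P K) (hσ : ∀ l, Measurable (S.σ l)) :
    iIndepFun (fun j ω => S.A j ω - S.muA) P :=
  h.indep.comp (fun _ x => S.Afun x - S.muA) fun _ => (measurable_Afun hσ).sub_const _

lemma indepFun_A_sub_eSum (hσ : ∀ l, Measurable (S.σ l))
    (hde : IndepFun (fun ω j => S.d j ω) (fun ω j i => S.e j i ω) P) :
    IndepFun (fun ω j => S.A j ω - S.muA) (fun ω j => S.eSum j ω) P := by
  have hA := measurable_Afun hσ
  refine hde.comp (φ := fun (x : Fin S.numGroups → ℝ) j => S.Afun (x j) - S.muA)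
    (ψ := fun (y : (j : Fin S.numGroups) → Fin (S.size j) → EuclideanSpace ℝ (Fin L)) j =>
      ∑ i, y j i) ?_ ?_
  · fun_prop
  · fun_prop

/-- Reading averages of squared projections as quadratic forms lets an operator-norm condition
control the conditional variance. -/
lemma quadratic_outerE (ω : Ω) (b : EuclideanSpace ℝ (Fin L)) :
    b.ofLp ⬝ᵥ (S.outerE ω *ᵥ b.ofLp) = S.n⁻¹ * ∑ j, inner ℝ b (S.eSum j ω) ^ 2 := by
  rw [outerE, Matrix.smul_mulVec, dotProduct_smul, smul_eq_mul]
  congr 1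
  simp only [Matrix.sum_mulVec, dotProduct_sum]
  refine Finset.sum_congr rfl fun j _ => ?_
  rw [Matrix.vecMulVec_mulVec, dotProduct_smul, EuclideanSpace.inner_eq_star_dotProduct]
  simp [sq, dotProduct_comm]

lemma quadratic_meanOuterE (hm : S.IsModel P) (b : EuclideanSpace ℝ (Fin L)) :
    b.ofLp ⬝ᵥ (S.meanOuterE P *ᵥ b.ofLp)
      = S.n⁻¹ * ∑ j, ∫ ω, inner ℝ b (S.eSum j ω) ^ 2 ∂P := by
  rw [meanOuterE, Matrix.smul_mulVec, dotProduct_smul, smul_eq_mul]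
  congr 1
  simp only [Matrix.sum_mulVec, dotProduct_sum]
  refine Finset.sum_congr rfl fun j _ => ?_
  have hE : ∀ l, MemLp (fun ω => S.eSum j ω l) 2 P := fun l =>
    (hm.memLp_eSum j).continuousLinearMap_comp
      (EuclideanSpace.proj l : EuclideanSpace ℝ (Fin L) →L[ℝ] ℝ)
  have hi : ∀ l m, Integrable (fun ω => b l * b m * (S.eSum j ω l * S.eSum j ω m)) P :=
    fun l m => ((hE l).integrable_mul (hE m)).const_mul _
  have hexp : ∀ ω, inner ℝ b (S.eSum j ω) ^ 2
      = ∑ l, ∑ m, b l * b m * (S.eSum j ω l * S.eSum j ω m) := fun ω => by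
    rw [sq, EuclideanSpace.inner_eq_star_dotProduct]
    simp only [star_trivial, dotProduct, Finset.sum_mul_sum]
    exact Finset.sum_congr rfl fun l _ => Finset.sum_congr rfl fun m _ => by ring
  simp_rw [hexp]
  rw [integral_finsetSum _ fun l _ => integrable_finsetSum _ fun m _ => hi l m]
  simp only [dotProduct, Matrix.mulVec, Matrix.of_apply, Finset.mul_sum]
  refine Finset.sum_congr rfl fun l _ => ?_
  rw [integral_finsetSum _ fun m _ => hi l m]
  refine Finset.sum_congr rfl fun m _ => ?_
  rw [integral_const_mul]
  ring

/-- The score splits into a part that is centered given the errors and a part that depends on the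
errors only. -/
lemma score_eq (ω : Ω) :
    S.score ω = ∑ j, inner ℝ (S.A j ω - S.muA) ((√S.n)⁻¹ • S.eSum j ω) + S.meanScore ω := by
  have hA : ∀ j, (S.d j ω - S.muD) * S.epsSum j ω = inner ℝ (S.A j ω) (S.eSum j ω) := by
    intro j
    rw [epsSum, eSum, inner_sum, Finset.mul_sum]
    refine Finset.sum_congr rfl fun i _ => ?_
    simp only [eps, A, Afun, EuclideanSpace.inner_eq_star_dotProduct, dotProduct, Finset.mul_sum,
      star_trivial]
    exact Finset.sum_congr rfl fun l _ => by ring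
  have hm : ∀ j, ∑ i, inner ℝ S.muA (S.e j i ω) = inner ℝ S.muA (S.eSum j ω) := fun j => by
    rw [eSum, inner_sum]
  simp only [score, meanScore, hA, hm, inner_smul_right, inner_sub_left, ← Finset.mul_sum,
    Finset.sum_sub_distrib]
  ring

variable [IsProbabilityMeasure P]

lemma memLp_Afun (h : S.RegressorCond P K) (hσ : ∀ l, Measurable (S.σ l))
    (hb : ∀ l, ∀ᵐ x ∂S.law, |S.σ l x| ≤ K) (j : Fin S.numGroups) : MemLp S.Afun 4 S.law :=
  (h.memLp_center j).of_le_mul (measurable_Afun hσ).aestronglyMeasurable (norm_Afun_le hb)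

lemma integral_norm_Afun_pow_four_le (h : S.RegressorCond P K) (hσ : ∀ l, Measurable (S.σ l))
    (hb : ∀ l, ∀ᵐ x ∂S.law, |S.σ l x| ≤ K) (j : Fin S.numGroups) :
    ∫ x, ‖S.Afun x‖ ^ 4 ∂S.law ≤ (L * K ^ 2) ^ 2 * (16 * K) := by
  calc ∫ x, ‖S.Afun x‖ ^ 4 ∂S.law ≤ ∫ x, (L * K ^ 2) ^ 2 * (x - S.muD) ^ 4 ∂S.law := by
        refine integral_mono_ae (integrable_pow_four (memLp_Afun h hσ hb j).norm)
          ((integrable_pow_four (h.memLp_center j)).const_mul _) ?_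
        filter_upwards [norm_Afun_le hb] with x hx
        calc ‖S.Afun x‖ ^ 4 ≤ (√(L * K ^ 2) * ‖x - S.muD‖) ^ 4 :=
              pow_le_pow_left₀ (norm_nonneg _) hx 4
          _ = ((√(L * K ^ 2)) ^ 2) ^ 2 * |x - S.muD| ^ 4 := by
              rw [Real.norm_eq_abs]
              ring
          _ = (L * K ^ 2) ^ 2 * (x - S.muD) ^ 4 := by
              rw [Real.sq_sqrt (by positivity), Even.pow_abs (by decide : Even 4)]
    _ ≤ (L * K ^ 2) ^ 2 * (16 * K) := by
        rw [integral_const_mul]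
        exact mul_le_mul_of_nonneg_left (h.integral_center_pow_four_le j) (sq_nonneg _)

lemma integral_Afun (h : S.RegressorCond P K) (hσ : ∀ l, Measurable (S.σ l))
    (hb : ∀ l, ∀ᵐ x ∂S.law, |S.σ l x| ≤ K) (j : Fin S.numGroups) :
    ∫ x, S.Afun x ∂S.law = S.muA := by
  have := h.isProbabilityMeasure_law j
  have hi : Integrable S.Afun S.law := (memLp_Afun h hσ hb j).integrable (by norm_num)
  ext l
  exact ((EuclideanSpace.proj l : EuclideanSpace ℝ (Fin L) →L[ℝ] ℝ).integral_comp_comm hi).symm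

lemma isProbabilityMeasure_scoreLaw (h : S.RegressorCond P K) (hσ : ∀ l, Measurable (S.σ l))
    (j : Fin S.numGroups) : IsProbabilityMeasure S.scoreLaw :=
  have := h.isProbabilityMeasure_law j
  Measure.isProbabilityMeasure_map ((measurable_Afun hσ).sub_const _).aemeasurable

lemma memLp_id_scoreLaw (h : S.RegressorCond P K) (hσ : ∀ l, Measurable (S.σ l))
    (hb : ∀ l, ∀ᵐ x ∂S.law, |S.σ l x| ≤ K) (j : Fin S.numGroups) :
    MemLp (fun b => b) 4 S.scoreLaw := by
  have := h.isProbabilityMeasure_law j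
  rw [scoreLaw, memLp_map_measure_iff (by fun_prop)
    ((measurable_Afun hσ).sub_const _).aemeasurable]
  exact (memLp_Afun h hσ hb j).sub (memLp_const _)

/-- The factor 16 = 8 + 8 comes from ‖a - μ‖⁴ ≤ 8‖a‖⁴ + 8‖μ‖⁴ together with ‖μ_A‖⁴ ≤ E‖A‖⁴. -/
lemma integral_norm_pow_four_scoreLaw_le (h : S.RegressorCond P K)
    (hσ : ∀ l, Measurable (S.σ l)) (hb : ∀ l, ∀ᵐ x ∂S.law, |S.σ l x| ≤ K)
    (j : Fin S.numGroups) :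
    ∫ b, ‖b‖ ^ 4 ∂S.scoreLaw ≤ 16 * ((L * K ^ 2) ^ 2 * (16 * K)) := by
  have := h.isProbabilityMeasure_law j
  have hA := memLp_Afun h hσ hb j
  have hA4 := integral_norm_Afun_pow_four_le h hσ hb j
  have hmu : ‖S.muA‖ ^ 4 ≤ ∫ x, ‖S.Afun x‖ ^ 4 ∂S.law := by
    have h0 : ‖S.muA‖ ≤ ∫ x, ‖S.Afun x‖ ∂S.law := by
      rw [← integral_Afun h hσ hb j]
      exact norm_integral_le_integral_norm _
    have h1 : (∫ x, ‖S.Afun x‖ ∂S.law) ^ 2 ≤ ∫ x, ‖S.Afun x‖ ^ 2 ∂S.law :=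
      sq_integral_le_integral_sq (hA.norm.mono_exponent (by norm_num))
    have h2 := sq_integral_le_integral_sq (memLp_sq_of_memLp_four hA.norm)
    simp only [← pow_mul] at h2
    calc ‖S.muA‖ ^ 4 = (‖S.muA‖ ^ 2) ^ 2 := by ring
      _ ≤ (∫ x, ‖S.Afun x‖ ^ 2 ∂S.law) ^ 2 :=
          pow_le_pow_left₀ (sq_nonneg _) ((pow_le_pow_left₀ (norm_nonneg _) h0 2).trans h1) 2
      _ ≤ _ := h2
  rw [scoreLaw, integral_map ((measurable_Afun hσ).sub_const _).aemeasurable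
    (by fun_prop : AEStronglyMeasurable (fun b : EuclideanSpace ℝ (Fin L) => ‖b‖ ^ 4) _)]
  calc ∫ x, ‖S.Afun x - S.muA‖ ^ 4 ∂S.law
      ≤ ∫ x, (8 * ‖S.Afun x‖ ^ 4 + 8 * ‖S.muA‖ ^ 4) ∂S.law := by
        refine integral_mono (integrable_pow_four (hA.sub (memLp_const _)).norm)
          (((integrable_pow_four hA.norm).const_mul 8).add (integrable_const _)) fun x => ?_
        refine (pow_le_pow_left₀ (norm_nonneg _) (norm_sub_le _ _) 4).trans ?_
        have := add_pow_le (norm_nonneg (S.Afun x)) (norm_nonneg S.muA) 4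
        norm_num at this
        change _ ≤ 8 * ‖S.Afun x‖ ^ 4 + 8 * ‖S.muA‖ ^ 4
        linarith
    _ = 8 * ∫ x, ‖S.Afun x‖ ^ 4 ∂S.law + 8 * ‖S.muA‖ ^ 4 := by
        rw [integral_add ((integrable_pow_four hA.norm).const_mul 8) (integrable_const _),
          integral_const_mul]
        simp
    _ ≤ _ := by linarith

lemma integral_inner_scoreLaw (h : S.RegressorCond P K) (hσ : ∀ l, Measurable (S.σ l))
    (hb : ∀ l, ∀ᵐ x ∂S.law, |S.σ l x| ≤ K) (j : Fin S.numGroups)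
    (y : EuclideanSpace ℝ (Fin L)) : ∫ b, inner ℝ b y ∂S.scoreLaw = 0 := by
  have := h.isProbabilityMeasure_law j
  have := isProbabilityMeasure_scoreLaw h hσ j
  have hA : Integrable S.Afun S.law := (memLp_Afun h hσ hb j).integrable (by norm_num)
  have hid : Integrable (fun b => b) S.scoreLaw :=
    (memLp_id_scoreLaw h hσ hb j).integrable (by norm_num)
  have hmean : ∫ b, b ∂S.scoreLaw = 0 := by
    rw [scoreLaw, integral_map ((measurable_Afun hσ).sub_const _).aemeasurable (by fun_prop),
      integral_sub hA (integrable_const _), integral_Afun h hσ hb j]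
    simp
  simp_rw [real_inner_comm y]
  rw [integral_inner hid, hmean, inner_zero_right]

/-- `S_{e,1}²` as an iterated integral. -/
lemma Se1_sq_eq (hm : S.IsModel P) (h : S.RegressorCond P K)
    (hb : ∀ l, ∀ᵐ x ∂S.law, |S.σ l x| ≤ K)
    (hde : IndepFun (fun ω j => S.d j ω) (fun ω j i => S.e j i ω) P) :
    S.Se1 P ^ 2 = S.n⁻¹ * ∑ j, ∫ b, ∫ ω, inner ℝ b (S.eSum j ω) ^ 2 ∂P ∂S.scoreLaw := by
  have hn : 0 ≤ S.n := Nat.cast_nonneg _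
  rw [Se1, Real.sq_sqrt (mul_nonneg (inv_nonneg.2 hn)
    (Finset.sum_nonneg fun j _ => integral_nonneg fun ω => sq_nonneg _))]
  congr 1
  refine Finset.sum_congr rfl fun j _ => ?_
  have := isProbabilityMeasure_scoreLaw h hm.measurable_σ j
  have hB := hasLaw_A_sub h hm.measurable_σ j
  have hE := (hm.memLp_eSum j).aestronglyMeasurable.aemeasurable
  -- Independence makes the joint law a product, so the errors can be integrated first with the
  -- value b of Aⱼ - μ_A fixed.
  have hind : IndepFun (fun ω => S.A j ω - S.muA) (S.eSum j) P :=
    (indepFun_A_sub_eSum hm.measurable_σ hde).comp (measurable_pi_apply j) (measurable_pi_apply j)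
  have hmap := (indepFun_iff_map_prod_eq_prod_map_map hB.aemeasurable hE).1 hind
  rw [hB.map_eq] at hmap
  have hmeas : AEStronglyMeasurable
      (fun z : EuclideanSpace ℝ (Fin L) × EuclideanSpace ℝ (Fin L) => inner ℝ z.1 z.2 ^ 2)
      (S.scoreLaw.prod (P.map (S.eSum j))) := by fun_prop
  have hprobE : IsProbabilityMeasure (P.map (S.eSum j)) := Measure.isProbabilityMeasure_map hE
  have hint : Integrable
      (fun z : EuclideanSpace ℝ (Fin L) × EuclideanSpace ℝ (Fin L) => inner ℝ z.1 z.2 ^ 2)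
      (S.scoreLaw.prod (P.map (S.eSum j))) := by
    have h1 : Integrable (fun b => ‖b‖ ^ 2) S.scoreLaw :=
      ((memLp_id_scoreLaw h hm.measurable_σ hb j).mono_exponent
        (by norm_num : (2 : ENNReal) ≤ 4)).norm.integrable_sq
    have h2 : Integrable (fun b => ‖b‖ ^ 2) (P.map (S.eSum j)) :=
      (integrable_map_measure (by fun_prop) hE).2 (hm.memLp_eSum j).norm.integrable_sq
    refine (h1.mul_prod h2).mono' hmeas (ae_of_all _ fun z => ?_)
    rw [norm_pow, ← mul_pow]
    exact pow_le_pow_left₀ (norm_nonneg _) (norm_inner_le_norm _ _) 2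
  calc ∫ ω, inner ℝ (S.A j ω - S.muA) (S.eSum j ω) ^ 2 ∂P
      = ∫ z, inner ℝ z.1 z.2 ^ 2 ∂(S.scoreLaw.prod (P.map (S.eSum j))) := by
        rw [← hmap, integral_map (hB.aemeasurable.prodMk hE) (hmap ▸ hmeas)]
    _ = ∫ b, ∫ y, inner ℝ b y ^ 2 ∂(P.map (S.eSum j)) ∂S.scoreLaw := integral_prod _ hint
    _ = ∫ b, ∫ ω, inner ℝ b (S.eSum j ω) ^ 2 ∂P ∂S.scoreLaw := by
        congr 1
        ext b
        rw [integral_map hE (by fun_prop)]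

/-- The conditional variance is close to `S_{e,1}²` when the outer products of the errors are close
to their means. -/
lemma abs_condVar_sub_le (hm : S.IsModel P) (h : S.RegressorCond P K)
    (hb : ∀ l, ∀ᵐ x ∂S.law, |S.σ l x| ≤ K)
    (hde : IndepFun (fun ω j => S.d j ω) (fun ω j i => S.e j i ω) P) (j₀ : Fin S.numGroups)
    (ω : Ω) :
    |S.condVar ω - S.Se1 P ^ 2| ≤ (1 + 16 * ((L * K ^ 2) ^ 2 * (16 * K))) *
      ‖Matrix.toEuclideanCLM (n := Fin L) (𝕜 := ℝ) (S.outerE ω - S.meanOuterE P)‖ := by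
  have := isProbabilityMeasure_scoreLaw h hm.measurable_σ j₀
  set T := Matrix.toEuclideanCLM (n := Fin L) (𝕜 := ℝ) (S.outerE ω - S.meanOuterE P) with hT
  have hid : MemLp (fun b => b) 4 S.scoreLaw := memLp_id_scoreLaw h hm.measurable_σ hb j₀
  have hid2 : Integrable (fun b => ‖b‖ ^ 2) S.scoreLaw :=
    (hid.mono_exponent (by norm_num : (2 : ENNReal) ≤ 4)).norm.integrable_sq
  -- Jensen bounds the square of the left side by the fourth moment; then v ≤ 1 + v².
  have hnorm : ∫ b, ‖b‖ ^ 2 ∂S.scoreLaw ≤ 1 + 16 * ((L * K ^ 2) ^ 2 * (16 * K)) := by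
    have h1 := integral_norm_pow_four_scoreLaw_le h hm.measurable_σ hb j₀
    have h2 := sq_integral_le_integral_sq (memLp_sq_of_memLp_four hid.norm)
    simp only [← pow_mul] at h2
    nlinarith [sq_nonneg (∫ b, ‖b‖ ^ 2 ∂S.scoreLaw - 1), h2.trans h1]
  have hquad : ∀ b : EuclideanSpace ℝ (Fin L), inner ℝ b (T b)
      = S.n⁻¹ * ∑ j, inner ℝ b (S.eSum j ω) ^ 2
        - S.n⁻¹ * ∑ j, ∫ ω', inner ℝ b (S.eSum j ω') ^ 2 ∂P := by
    intro b
    rw [← quadratic_outerE, ← quadratic_meanOuterE hm, ← dotProduct_sub, ← Matrix.sub_mulVec,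
      EuclideanSpace.inner_eq_star_dotProduct, dotProduct_comm]
    rfl
  have hi1 : ∀ j, Integrable (fun b => inner ℝ b (S.eSum j ω) ^ 2) S.scoreLaw := fun j => by
    refine (hid2.mul_const (‖S.eSum j ω‖ ^ 2)).mono' (by fun_prop) (ae_of_all _ fun b => ?_)
    rw [norm_pow, ← mul_pow]
    exact pow_le_pow_left₀ (norm_nonneg _) (norm_inner_le_norm _ _) 2
  have hi2 : ∀ j, Integrable (fun b => ∫ ω', inner ℝ b (S.eSum j ω') ^ 2 ∂P) S.scoreLaw := by
    intro j
    have hEi := (hm.memLp_eSum j).norm.integrable_sq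
    have hEm := (hm.memLp_eSum j).aestronglyMeasurable
    refine (hid2.mul_const (∫ ω', ‖S.eSum j ω'‖ ^ 2 ∂P)).mono' ?_ (ae_of_all _ fun b => ?_)
    · have hmeas : AEStronglyMeasurable (fun z : EuclideanSpace ℝ (Fin L) × Ω =>
          inner ℝ z.1 (S.eSum j z.2) ^ 2) (S.scoreLaw.prod P) :=
        (AEStronglyMeasurable.inner (by fun_prop) hEm.comp_snd).pow 2
      exact hmeas.integral_prod_right'
    · rw [Real.norm_of_nonneg (integral_nonneg fun ω' => sq_nonneg _), ← integral_const_mul]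
      refine integral_mono_of_nonneg (ae_of_all _ fun _ => sq_nonneg _) (hEi.const_mul _)
        (ae_of_all _ fun ω' => ?_)
      change inner ℝ b (S.eSum j ω') ^ 2 ≤ ‖b‖ ^ 2 * ‖S.eSum j ω'‖ ^ 2
      rw [← mul_pow, ← sq_abs (inner ℝ b (S.eSum j ω'))]
      exact pow_le_pow_left₀ (abs_nonneg _) (abs_real_inner_le_norm _ _) 2
  -- Averaging ⟨b, T b⟩ over the law of Aⱼ - μ_A gives exactly the difference, so the errors enter
  -- the bound only through ‖T‖.
  have heq : S.condVar ω - S.Se1 P ^ 2 = ∫ b, inner ℝ b (T b) ∂S.scoreLaw := by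
    simp_rw [hquad]
    rw [integral_sub ((integrable_finsetSum _ fun j _ => hi1 j).const_mul _)
      ((integrable_finsetSum _ fun j _ => hi2 j).const_mul _), integral_const_mul,
      integral_const_mul, integral_finsetSum _ fun j _ => hi1 j,
      integral_finsetSum _ fun j _ => hi2 j, Se1_sq_eq hm h hb hde, condVar]
  rw [heq, ← Real.norm_eq_abs]
  refine (norm_integral_le_integral_norm _).trans ?_
  calc ∫ b, ‖(inner ℝ b (T b) : ℝ)‖ ∂S.scoreLaw ≤ ∫ b, ‖b‖ ^ 2 * ‖T‖ ∂S.scoreLaw := by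
        refine integral_mono_of_nonneg (ae_of_all _ fun _ => norm_nonneg _) (hid2.mul_const _)
          (ae_of_all _ fun b => ?_)
        change ‖(inner ℝ b (T b) : ℝ)‖ ≤ ‖b‖ ^ 2 * ‖T‖
        calc ‖(inner ℝ b (T b) : ℝ)‖ ≤ ‖b‖ * ‖T b‖ := norm_inner_le_norm _ _
          _ ≤ ‖b‖ * (‖T‖ * ‖b‖) := by gcongr; exact T.le_opNorm b
          _ = ‖b‖ ^ 2 * ‖T‖ := by ring
    _ ≤ _ := by
        rw [integral_mul_const]
        exact mul_le_mul_of_nonneg_right hnorm (norm_nonneg _)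

end GroupSample

/-! ### Characteristic functions at moving arguments. -/

lemma abs_exp_neg_sub_exp_neg_le {x y : ℝ} (hx : 0 ≤ x) (hy : 0 ≤ y) :
    |Real.exp (-x) - Real.exp (-y)| ≤ |x - y| := by
  wlog h : x ≤ y generalizing x y
  · rw [abs_sub_comm, abs_sub_comm x y]
    exact this hy hx (le_of_not_ge h)
  have h1 : Real.exp (-y) = Real.exp (-x) * Real.exp (-(y - x)) := by
    rw [← Real.exp_add]
    ring_nf
  have h2 := Real.add_one_le_exp (-(y - x))
  have h3 : Real.exp (-x) ≤ 1 := Real.exp_le_one_iff.2 (by linarith)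
  have h4 : Real.exp (-y) ≤ Real.exp (-x) := Real.exp_le_exp.2 (by linarith)
  rw [abs_of_nonneg (by linarith), abs_of_nonpos (by linarith), h1]
  nlinarith [Real.exp_pos (-x)]

/-- Moving the argument into the variable turns convergence at varying arguments into a Slutsky
statement. -/
lemma charFun_map_const_mul_one {Ω : Type*} [MeasurableSpace Ω] {P : Measure Ω} {X : Ω → ℝ}
    (hX : AEMeasurable X P) (r : ℝ) :
    charFun (P.map fun ω => r * X ω) 1 = charFun (P.map X) r := by
  change charFun (P.map ((fun x => r * x) ∘ X)) 1 = _
  rw [← AEMeasurable.map_map_of_aemeasurable (by fun_prop) hX, charFun_map_mul, mul_one]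

section Slutsky

variable {Ω Ω' : Type*} [MeasurableSpace Ω] [MeasurableSpace Ω'] {P : Measure Ω} {Q : Measure Ω'}
  [IsProbabilityMeasure P] [IsProbabilityMeasure Q] {Z : ℕ → Ω → ℝ} {Z₀ : Ω' → ℝ}

lemma tendsto_charFun_of_tendstoInDistribution
    (hZ : TendstoInDistribution Z atTop Z₀ (fun _ => P) Q) {s : ℕ → ℝ} {s₀ : ℝ}
    (hs : Tendsto s atTop (𝓝 s₀)) :
    Tendsto (fun k => charFun (P.map (Z k)) (s k)) atTop (𝓝 (charFun (Q.map Z₀) s₀)) := by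
  have hs' : TendstoInMeasure P (fun k (_ : Ω) => s k) atTop (fun _ => s₀) :=
    tendstoInMeasure_of_tendsto_ae (fun _ => aestronglyMeasurable_const) (ae_of_all _ fun _ => hs)
  have h := hZ.continuous_comp_prodMk_of_tendstoInMeasure_const
    (g := fun x : ℝ × ℝ => x.2 * x.1) (by fun_prop) hs' fun _ => aemeasurable_const
  have h1 := ProbabilityMeasure.tendsto_iff_tendsto_charFun.1 h.tendsto 1
  simpa only [ProbabilityMeasure.coe_mk, charFun_map_const_mul_one hZ.aemeasurable_limit,
    fun k => charFun_map_const_mul_one (hZ.forall_aemeasurable k)] using h1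

/-- Convergence in distribution implies convergence of the characteristic functions along bounded
sequences of arguments. -/
lemma tendsto_charFun_sub_of_bounded
    (hZ : TendstoInDistribution Z atTop Z₀ (fun _ => P) Q) {s : ℕ → ℝ} {R : ℝ}
    (hs : ∀ k, |s k| ≤ R) :
    Tendsto (fun k => charFun (P.map (Z k)) (s k) - charFun (Q.map Z₀) (s k)) atTop (𝓝 0) := by
  have : IsProbabilityMeasure (Q.map Z₀) := Measure.isProbabilityMeasure_map hZ.aemeasurable_limit
  refine tendsto_of_subseq_tendsto fun ns hns => ?_
  -- By compactness the arguments converge along a further subsequence, where both characteristic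
  -- functions have the same limit.
  obtain ⟨a, -, φ, hφ, hlim⟩ := tendsto_subseq_of_bounded (s := Metric.closedBall (0 : ℝ) R)
    Metric.isBounded_closedBall (x := fun n => s (ns n)) fun n => by
      simpa [Real.norm_eq_abs] using hs (ns n)
  have hsub : TendstoInDistribution (fun n => Z (ns (φ n))) atTop Z₀ (fun _ => P) Q :=
    ⟨fun n => hZ.forall_aemeasurable _, hZ.aemeasurable_limit,
      hZ.tendsto.comp (hns.comp hφ.tendsto_atTop)⟩
  refine ⟨φ, ?_⟩
  have h1 := tendsto_charFun_of_tendstoInDistribution hsub hlim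
  have h2 := (continuous_charFun (μ := Q.map Z₀)).continuousAt.tendsto.comp hlim
  simpa using h1.sub h2

end Slutsky

/-! ### Central limit theorem for the score. -/

namespace GroupSample

variable {Ω : Type*} [MeasurableSpace Ω] {L p : ℕ}

section Single

variable {S : GroupSample Ω L p} {P : Measure Ω} {K : ℝ}

/-- The condition on `S_{e,1} / S_ε` rules out degenerate samples. -/
lemma pos_of_inv_le_div (hK : 0 < K) (h : K⁻¹ ≤ S.Se1 P / S.Seps P) :
    0 < S.Seps P ∧ 0 < S.Se1 P ∧ 0 < S.n ∧ Nonempty (Fin S.numGroups) := by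
  have hdiv : 0 < S.Se1 P / S.Seps P := (inv_pos.2 hK).trans_le h
  have h1 : 0 < S.Seps P := by
    refine lt_of_le_of_ne (Real.sqrt_nonneg _) fun h0 => ?_
    rw [← h0, div_zero] at hdiv
    exact hdiv.false
  have h2 : 0 < S.Se1 P := (div_pos_iff_of_pos_right h1).1 hdiv
  have h3 : S.n ≠ 0 := fun h0 => by
    rw [Seps, h0, inv_zero, zero_mul, Real.sqrt_zero] at h1
    exact h1.false
  refine ⟨h1, h2, lt_of_le_of_ne (Nat.cast_nonneg _) h3.symm, ?_⟩
  by_contra hne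
  rw [not_nonempty_iff] at hne
  exact h3 (by simp [n])

lemma Se1_le_Sdeps : S.Se1 P ≤ S.Sdeps P :=
  Real.le_sqrt_of_sq_le (le_add_of_nonneg_right (sq_nonneg _))

lemma Sdeps_sq : S.Sdeps P ^ 2 = S.Se1 P ^ 2 + S.Se2 P ^ 2 :=
  Real.sq_sqrt (by positivity)

lemma Se2_le_Sdeps : S.Se2 P ≤ S.Sdeps P :=
  Real.le_sqrt_of_sq_le (le_add_of_nonneg_left (sq_nonneg _))

lemma meanScore_eq (ω : Ω) :
    S.meanScore ω = (√S.n)⁻¹ * ∑ j, inner ℝ S.muA (S.eSum j ω) := by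
  simp only [meanScore, eSum, inner_sum]

lemma IsModel.measurable_eSum (hm : S.IsModel P) (j : Fin S.numGroups) :
    Measurable (S.eSum j) := by
  have := hm.measurable_e
  unfold eSum
  fun_prop

lemma IsModel.measurable_meanScore (hm : S.IsModel P) : Measurable S.meanScore := by
  have := hm.measurable_e
  unfold meanScore
  fun_prop

/-- Normalizing the mean score through `S_{e,2}` loses nothing even when `S_{e,2}` vanishes. -/
lemma meanScore_div_Sdeps_ae_eq (hm : S.IsModel P) :
    ∀ᵐ ω ∂P, S.meanScore ω / S.Sdeps P
      = S.Se2 P / S.Sdeps P * ((S.Se2 P)⁻¹ * S.meanScore ω) := by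
  -- If S_{e,2} = 0, the mean score has zero second moment and vanishes almost surely, so the
  -- convention 0⁻¹ = 0 does no harm.
  rcases eq_or_ne (S.Se2 P) 0 with h0 | h0
  · have hmem : MemLp S.meanScore 2 P := by
      have heq : S.meanScore = fun ω => (√S.n)⁻¹ * ∑ j, inner ℝ S.muA (S.eSum j ω) :=
        funext meanScore_eq
      rw [heq]
      have hsum : MemLp (fun ω => ∑ j, (inner ℝ S.muA (S.eSum j ω) : ℝ)) 2 P :=
        memLp_finsetSum _ fun j _ => MemLp.const_inner (𝕜 := ℝ) S.muA (hm.memLp_eSum j)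
      exact hsum.const_mul _
    have hint : ∫ ω, S.meanScore ω ^ 2 ∂P = 0 := by
      rwa [Se2, Real.sqrt_eq_zero (integral_nonneg fun ω => sq_nonneg _)] at h0
    filter_upwards [(integral_eq_zero_iff_of_nonneg (fun ω => sq_nonneg _)
      hmem.integrable_sq).1 hint] with ω hω
    have : S.meanScore ω = 0 := by simpa using hω
    simp [this]
  · refine ae_of_all _ fun ω => ?_
    field_simp

lemma aemeasurable_score (hm : S.IsModel P) (h : S.RegressorCond P K) :
    AEMeasurable S.score P := by
  have hd : ∀ j, AEMeasurable (S.d j) P := fun j => (h.hasLaw j).aemeasurable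
  have he := hm.measurable_e
  have hσ : ∀ j l, AEMeasurable (fun ω => S.σ l (S.d j ω)) P := fun j l =>
    (hm.measurable_σ l).comp_aemeasurable (hd j)
  unfold score epsSum eps
  fun_prop

variable [IsProbabilityMeasure P]

/-- Conditional Gaussian approximation of the centered part of the score given the errors. -/
lemma norm_prod_charFun_scoreLaw_sub_le (hm : S.IsModel P) (h : S.RegressorCond P K)
    (hb : ∀ l, ∀ᵐ x ∂S.law, |S.σ l x| ≤ K)
    (hde : IndepFun (fun ω j => S.d j ω) (fun ω j i => S.e j i ω) P) (j₀ : Fin S.numGroups)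
    (hpos : 0 < S.Se1 P) (t : ℝ) {η : ℝ} (hη : 0 < η) (ω : Ω) {C V M : ℝ}
    (hC : C = 1 + 16 * ((L * K ^ 2) ^ 2 * (16 * K)))
    (hV : V = t ^ 2 * C * ((S.Se1 P ^ 2)⁻¹ *
      ‖Matrix.toEuclideanCLM (n := Fin L) (𝕜 := ℝ) (S.outerE ω - S.meanOuterE P)‖))
    (hM : M = t ^ 4 * C * ((S.Se1 P ^ 4)⁻¹ * ((S.n ^ 2)⁻¹ * ∑ j, ‖S.eSum j ω‖ ^ 4))) :
    ‖∏ j, charFun S.scoreLaw ((t / S.Sdeps P * (√S.n)⁻¹) • S.eSum j ω)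
        - (Real.exp (-(t * (S.Se1 P / S.Sdeps P)) ^ 2 / 2) : ℝ)‖
      ≤ 2 * η * (t ^ 2 + V) + (2 / η + 1) * M + V := by
  have := isProbabilityMeasure_scoreLaw h hm.measurable_σ j₀
  have hn : 0 ≤ S.n := Nat.cast_nonneg _
  have hS := hpos.trans_le (Se1_le_Sdeps (S := S) (P := P))
  have hid := memLp_id_scoreLaw h hm.measurable_σ hb j₀
  have hK0 : 0 ≤ K := (integral_nonneg fun x => by positivity).trans (h.moment_d j₀)
  have hC0 : 0 ≤ C := by rw [hC]; positivity
  set r := t / S.Sdeps P * (√S.n)⁻¹ with hr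
  have hr2 : r ^ 2 = (t / S.Sdeps P) ^ 2 * S.n⁻¹ := by
    rw [hr, mul_pow, inv_pow, Real.sq_sqrt hn]
  have hmem : ∀ y : EuclideanSpace ℝ (Fin L), MemLp (fun b => inner ℝ b y) 4 S.scoreLaw :=
    fun y => hid.inner_const y
  have hmain := norm_prod_charFun_sub_gaussian_le (ν := S.scoreLaw)
    (y := fun j => r • S.eSum j ω) (fun j => hmem _)
    (fun j => integral_inner_scoreLaw h hm.measurable_σ hb j₀ _) hη
  have hvar : ∑ j, ∫ b, inner ℝ b (r • S.eSum j ω) ^ 2 ∂S.scoreLaw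
      = (t / S.Sdeps P) ^ 2 * S.condVar ω := by
    simp only [inner_smul_right, mul_pow, integral_const_mul, ← Finset.mul_sum, condVar]
    rw [hr2, mul_assoc]
  have hfour : ∑ j, ∫ b, inner ℝ b (r • S.eSum j ω) ^ 4 ∂S.scoreLaw ≤ M := by
    have hj : ∀ j, ∫ b, inner ℝ b (S.eSum j ω) ^ 4 ∂S.scoreLaw ≤ C * ‖S.eSum j ω‖ ^ 4 := by
      intro j
      calc ∫ b, inner ℝ b (S.eSum j ω) ^ 4 ∂S.scoreLaw
          ≤ ∫ b, ‖b‖ ^ 4 * ‖S.eSum j ω‖ ^ 4 ∂S.scoreLaw := by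
            refine integral_mono (integrable_pow_four (hmem _))
              ((integrable_pow_four hid.norm).mul_const _) fun b => ?_
            change inner ℝ b (S.eSum j ω) ^ 4 ≤ ‖b‖ ^ 4 * ‖S.eSum j ω‖ ^ 4
            rw [← mul_pow, ← Even.pow_abs (by decide : Even 4) (inner ℝ b (S.eSum j ω))]
            exact pow_le_pow_left₀ (abs_nonneg _) (abs_real_inner_le_norm _ _) 4
        _ ≤ C * ‖S.eSum j ω‖ ^ 4 := by
            rw [integral_mul_const]
            refine mul_le_mul_of_nonneg_right ?_ (by positivity)
            rw [hC]
            exact (integral_norm_pow_four_scoreLaw_le h hm.measurable_σ hb j₀).trans (by linarith)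
    -- Since S_{e,1} ≤ S_{dε}, normalizing by S_{e,1} instead only enlarges the bound and brings it
    -- to the scale of the fourth-moment condition.
    have hr4 : r ^ 4 ≤ t ^ 4 * (S.Se1 P ^ 4)⁻¹ * (S.n ^ 2)⁻¹ := by
      calc r ^ 4 = (r ^ 2) ^ 2 := by ring
        _ = t ^ 4 * (S.Sdeps P ^ 4)⁻¹ * (S.n ^ 2)⁻¹ := by
            rw [hr2]
            field_simp
        _ ≤ _ := by
            gcongr
            exact Se1_le_Sdeps
    simp only [inner_smul_right, mul_pow, integral_const_mul, ← Finset.mul_sum]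
    calc r ^ 4 * ∑ j, ∫ b, inner ℝ b (S.eSum j ω) ^ 4 ∂S.scoreLaw
        ≤ t ^ 4 * (S.Se1 P ^ 4)⁻¹ * (S.n ^ 2)⁻¹ * ∑ j, C * ‖S.eSum j ω‖ ^ 4 := by
          refine mul_le_mul hr4 (Finset.sum_le_sum fun j _ => hj j)
            (Finset.sum_nonneg fun j _ => integral_nonneg fun b => by positivity) (by positivity)
      _ = M := by
          rw [hM, ← Finset.mul_sum]
          ring
  have hsc : (t / S.Sdeps P) ^ 2 ≤ t ^ 2 * (S.Se1 P ^ 2)⁻¹ := by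
    rw [div_pow, div_eq_mul_inv]
    gcongr
    exact Se1_le_Sdeps
  have hvardiff : |(t / S.Sdeps P) ^ 2 * S.condVar ω - (t * (S.Se1 P / S.Sdeps P)) ^ 2| ≤ V := by
    have heq : (t / S.Sdeps P) ^ 2 * S.condVar ω - (t * (S.Se1 P / S.Sdeps P)) ^ 2
        = (t / S.Sdeps P) ^ 2 * (S.condVar ω - S.Se1 P ^ 2) := by ring
    rw [heq, abs_mul, abs_of_nonneg (sq_nonneg _), hV]
    refine (mul_le_mul hsc (abs_condVar_sub_le hm h hb hde j₀ ω) (abs_nonneg _)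
      (by positivity)).trans_eq ?_
    rw [← hC]
    ring
  have hV0 : 0 ≤ V := (abs_nonneg _).trans hvardiff
  have hcond0 : 0 ≤ S.condVar ω := mul_nonneg (inv_nonneg.2 hn)
    (Finset.sum_nonneg fun j _ => integral_nonneg fun b => sq_nonneg _)
  have ht2 : (t * (S.Se1 P / S.Sdeps P)) ^ 2 ≤ t ^ 2 := by
    rw [mul_pow]
    refine mul_le_of_le_one_right (sq_nonneg _) (pow_le_one₀ (by positivity) ?_)
    exact (div_le_one hS).2 Se1_le_Sdeps
  rw [hvar] at hmain
  have hexp : |Real.exp (-((t / S.Sdeps P) ^ 2 * S.condVar ω) / 2)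
      - Real.exp (-(t * (S.Se1 P / S.Sdeps P)) ^ 2 / 2)| ≤ V := by
    rw [neg_div, neg_div]
    refine (abs_exp_neg_sub_exp_neg_le (by positivity) (by positivity)).trans ?_
    rw [← sub_div, abs_div, abs_two]
    linarith
  have hup : (t / S.Sdeps P) ^ 2 * S.condVar ω ≤ t ^ 2 + V := by
    linarith [(abs_le.1 hvardiff).2]
  -- The intermediate point is the Gaussian factor with the random conditional variance: the
  -- Lyapunov estimate handles one side, closeness of that variance to S_{e,1}² the other.
  refine (norm_sub_le_norm_sub_add_norm_sub _
    ((Real.exp (-((t / S.Sdeps P) ^ 2 * S.condVar ω) / 2) : ℝ) : ℂ) _).trans ?_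
  refine add_le_add (hmain.trans ?_) ?_
  · gcongr
  · rw [← Complex.ofReal_sub, Complex.norm_real, Real.norm_eq_abs]
    exact hexp

/-- The characteristic function of the normalized score, after integrating out the regressors. -/
lemma charFun_score_eq (hm : S.IsModel P) (h : S.RegressorCond P K)
    (hde : IndepFun (fun ω j => S.d j ω) (fun ω j i => S.e j i ω) P) (j₀ : Fin S.numGroups)
    (t : ℝ) :
    charFun (P.map fun ω => S.score ω / S.Sdeps P) t
      = ∫ ω, (∏ j, charFun S.scoreLaw ((t / S.Sdeps P * (√S.n)⁻¹) • S.eSum j ω))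
          * Complex.exp ((t * (S.meanScore ω / S.Sdeps P) : ℝ) * Complex.I) ∂P := by
  have := isProbabilityMeasure_scoreLaw h hm.measurable_σ j₀
  have hY : AEMeasurable (fun ω j => S.eSum j ω) P :=
    aemeasurable_pi_lambda _ fun j => (hm.measurable_eSum j).aemeasurable
  have hmain := integral_exp_sum_inner_mul (F := Fin S.numGroups → EuclideanSpace ℝ (Fin L))
    (fun j => hasLaw_A_sub h hm.measurable_σ j) (iIndepFun_A_sub h hm.measurable_σ) hY
    (indepFun_A_sub_eSum hm.measurable_σ hde)
    (y := fun j z => (t / S.Sdeps P * (√S.n)⁻¹) • z j) (fun j => by fun_prop)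
    (g := fun z => Complex.exp
      ((t / S.Sdeps P * ((√S.n)⁻¹ * ∑ j, inner ℝ S.muA (z j)) : ℝ) * Complex.I))
    (by fun_prop) (fun z => (Complex.norm_exp_ofReal_mul_I _).le)
  simp only [← meanScore_eq] at hmain
  rw [charFun_apply_real, integral_map ((aemeasurable_score hm h).div_const _) (by fun_prop)]
  have hre : ∀ ω, t * (S.meanScore ω / S.Sdeps P) = t / S.Sdeps P * S.meanScore ω :=
    fun ω => by ring
  simp only [hre]
  rw [← hmain]
  congr 1
  ext ω
  rw [← Complex.exp_add, ← add_mul, ← Complex.ofReal_add, ← Complex.ofReal_mul]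
  congr 3
  rw [S.score_eq]
  simp only [inner_smul_right, ← Finset.mul_sum]
  ring

end Single

/-- Central limit theorem for the score. -/
theorem tendstoInDistribution_score {P : Measure Ω} [IsProbabilityMeasure P]
    {S : ℕ → GroupSample Ω L p} {K : ℝ} (hK : 0 < K) (hmodel : ∀ k, (S k).IsModel P)
    (hregressor : ∀ k, (S k).RegressorCond P K) (hhetero : HeteroCond S P K)
    (hlatent : LatentCond S P) :
    TendstoInDistribution (fun k ω => (S k).score ω / (S k).Sdeps P) atTop id (fun _ => P)
      (gaussianReal 0 1) := by
  have hpos := fun k => pos_of_inv_le_div hK (hhetero.Se1_ge k)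
  have hSd : ∀ k, 0 < (S k).Sdeps P := fun k => (hpos k).2.1.trans_le Se1_le_Sdeps
  have hscore : ∀ k, AEMeasurable (fun ω => (S k).score ω / (S k).Sdeps P) P := fun k =>
    (aemeasurable_score (hmodel k) (hregressor k)).div_const _
  refine ⟨hscore, aemeasurable_id, ProbabilityMeasure.tendsto_iff_tendsto_charFun.2 fun t => ?_⟩
  simp only [ProbabilityMeasure.coe_mk, Measure.map_id, charFun_gaussianReal]
  -- Φ is the characteristic function of the centered part given the errors, γ its nonrandom
  -- Gaussian approximation, and g the factor depending on the errors alone.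
  let Φ : ℕ → Ω → ℂ := fun k ω => ∏ j, charFun (S k).scoreLaw
    ((t / (S k).Sdeps P * (√(S k).n)⁻¹) • (S k).eSum j ω)
  let γ : ℕ → ℝ := fun k => Real.exp (-(t * ((S k).Se1 P / (S k).Sdeps P)) ^ 2 / 2)
  let g : ℕ → Ω → ℂ := fun k ω =>
    Complex.exp ((t * ((S k).meanScore ω / (S k).Sdeps P) : ℝ) * Complex.I)
  have hγ0 : ∀ k, 0 ≤ γ k := fun k => (Real.exp_pos _).le
  have hγ1 : ∀ k, γ k ≤ 1 := fun k => Real.exp_le_one_iff.2 (by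
    rw [neg_div]
    exact neg_nonpos.2 (by positivity))
  have hΦ1 : ∀ k ω, ‖Φ k ω‖ ≤ 1 := fun k ω => by
    obtain ⟨-, -, -, ⟨j₀⟩⟩ := hpos k
    have := isProbabilityMeasure_scoreLaw (hregressor k) (hmodel k).measurable_σ j₀
    simp only [Φ, norm_prod]
    exact Finset.prod_le_one (fun _ _ => norm_nonneg _) fun j _ => norm_charFun_le_one _
  have hΦm : ∀ k, Measurable (Φ k) := fun k => by
    obtain ⟨-, -, -, ⟨j₀⟩⟩ := hpos k
    have := isProbabilityMeasure_scoreLaw (hregressor k) (hmodel k).measurable_σ j₀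
    have := (hmodel k).measurable_eSum
    exact Finset.measurable_fun_prod _ fun j _ => measurable_charFun.comp (by fun_prop)
  have hgm : ∀ k, Measurable (g k) := fun k => by
    have := (hmodel k).measurable_meanScore
    fun_prop
  have hg1 : ∀ k ω, ‖g k ω‖ = 1 := fun k ω => Complex.norm_exp_ofReal_mul_I _
  set C : ℝ := 1 + 16 * ((L * K ^ 2) ^ 2 * (16 * K)) with hC
  have hprob : TendstoInMeasure P (fun k ω => ‖Φ k ω - (γ k : ℂ)‖) atTop (fun _ => (0 : ℝ)) := by
    have hVlim := tendstoInMeasure_zero_const_mul (t ^ 2 * C) hlatent.lln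
    have hMlim := tendstoInMeasure_zero_const_mul (t ^ 4 * C) hlatent.moment
    refine tendstoInMeasure_zero_of_forall_lt fun ε hε => ?_
    -- Chosen so that 2η(t² + 1) = ε/4, using V < 1; the three pieces of the bound then total less
    -- than 3ε/4.
    set η : ℝ := ε / (8 * (t ^ 2 + 1)) with hη
    have hη0 : 0 < η := by positivity
    refine ⟨_, _, min 1 (ε / 4), ε / 4 / (2 / η + 1), by positivity, by positivity, hVlim, hMlim,
      fun k => ae_of_all _ fun ω hV hM => ?_⟩
    obtain ⟨-, hSe1, -, ⟨j₀⟩⟩ := hpos k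
    have hle := norm_prod_charFun_scoreLaw_sub_le (hmodel k) (hregressor k) (hhetero.bounded_σ k)
      (hhetero.indep_e k) j₀ hSe1 t hη0 ω hC rfl rfl
    rw [abs_norm]
    refine hle.trans_lt ?_
    simp only [smul_eq_mul] at hV hM
    set V := t ^ 2 * C * (((S k).Se1 P ^ 2)⁻¹ *
      ‖Matrix.toEuclideanCLM (n := Fin L) (𝕜 := ℝ) ((S k).outerE ω - (S k).meanOuterE P)‖)
    set M := t ^ 4 * C * (((S k).Se1 P ^ 4)⁻¹ * (((S k).n ^ 2)⁻¹ * ∑ j, ‖(S k).eSum j ω‖ ^ 4))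
    have hV1 := (le_abs_self V).trans_lt (lt_min_iff.1 hV).1
    have hV2 := (le_abs_self V).trans_lt (lt_min_iff.1 hV).2
    have hM1 := (le_abs_self M).trans_lt hM
    rw [lt_div_iff₀ (by positivity)] at hM1
    have h1 : 2 * η * (t ^ 2 + V) ≤ ε / 4 := by
      calc 2 * η * (t ^ 2 + V) ≤ 2 * η * (t ^ 2 + 1) := by gcongr
        _ = ε / 4 := by
            rw [hη]
            field_simp
            norm_num
    linarith
  have hmeanlim : Tendsto (fun k => ∫ ω, ‖Φ k ω - (γ k : ℂ)‖ ∂P) atTop (𝓝 0) := by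
    refine tendsto_integral_of_tendstoInMeasure_zero (C := 2) hprob (fun k ω => ?_)
      fun k => ((hΦm k).sub_const _).norm.aestronglyMeasurable
    rw [abs_norm]
    refine (norm_sub_le _ _).trans ?_
    rw [Complex.norm_real, Real.norm_of_nonneg (hγ0 k)]
    linarith [hΦ1 k ω, hγ1 k]
  have hgint : ∀ k, Integrable (g k) P := fun k =>
    Integrable.of_bound (hgm k).aestronglyMeasurable 1 (ae_of_all _ fun ω => (hg1 k ω).le)
  have hΦgint : ∀ k, Integrable (fun ω => (Φ k ω - (γ k : ℂ)) * g k ω) P := fun k => by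
    refine Integrable.of_bound (((hΦm k).sub_const _).mul (hgm k)).aestronglyMeasurable 2
      (ae_of_all _ fun ω => ?_)
    rw [norm_mul, hg1, mul_one]
    refine (norm_sub_le _ _).trans ?_
    rw [Complex.norm_real, Real.norm_of_nonneg (hγ0 k)]
    linarith [hΦ1 k ω, hγ1 k]
  have hfirst : Tendsto (fun k => ∫ ω, (Φ k ω - (γ k : ℂ)) * g k ω ∂P) atTop (𝓝 0) := by
    refine squeeze_zero_norm (fun k => ?_) hmeanlim
    refine (norm_integral_le_integral_norm _).trans_eq ?_
    simp only [norm_mul, hg1, mul_one]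
  have hgchar : ∀ k, ∫ ω, g k ω ∂P
      = charFun (P.map fun ω => ((S k).Se2 P)⁻¹ * (S k).meanScore ω)
        (t * ((S k).Se2 P / (S k).Sdeps P)) := fun k => by
    rw [charFun_apply_real, integral_map
      ((hmodel k).measurable_meanScore.const_mul _).aemeasurable (by fun_prop)]
    refine integral_congr_ae ?_
    filter_upwards [meanScore_div_Sdeps_ae_eq (hmodel k)] with ω hω
    simp only [g, hω]
    rw [← Complex.ofReal_mul, mul_assoc t]
  -- The share S_{e,2} / S_{dε} may oscillate; boundedness of the arguments is enough.
  have hratio : ∀ k, |t * ((S k).Se2 P / (S k).Sdeps P)| ≤ |t| := fun k => by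
    rw [abs_mul]
    refine mul_le_of_le_one_right (abs_nonneg _) ?_
    have h0 : 0 ≤ (S k).Se2 P := Real.sqrt_nonneg _
    rw [abs_of_nonneg (div_nonneg h0 (hSd k).le)]
    exact (div_le_one (hSd k)).2 Se2_le_Sdeps
  have hsecond := tendsto_charFun_sub_of_bounded hlatent.clt hratio
  simp only [Measure.map_id, charFun_gaussianReal] at hsecond
  have hthird : Tendsto (fun k => (γ k : ℂ) * (∫ ω, g k ω ∂P
      - Complex.exp (((t * ((S k).Se2 P / (S k).Sdeps P) : ℝ) : ℂ) * ((0 : ℝ) : ℂ) * Complex.I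
        - ((1 : NNReal) : ℂ) * ((t * ((S k).Se2 P / (S k).Sdeps P) : ℝ) : ℂ) ^ 2 / 2)))
      atTop (𝓝 0) := by
    simp only [← hgchar] at hsecond
    refine squeeze_zero_norm (fun k => ?_) (tendsto_zero_iff_norm_tendsto_zero.1 hsecond)
    rw [norm_mul, Complex.norm_real, Real.norm_of_nonneg (hγ0 k)]
    exact mul_le_of_le_one_left (norm_nonneg _) (hγ1 k)
  have hsum := (hfirst.add hthird).add (tendsto_const_nhds (x := Complex.exp
    ((t : ℂ) * ((0 : ℝ) : ℂ) * Complex.I - ((1 : NNReal) : ℂ) * (t : ℂ) ^ 2 / 2)))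
  rw [add_zero, zero_add] at hsum
  refine hsum.congr fun k => ?_
  obtain ⟨-, -, -, ⟨j₀⟩⟩ := hpos k
  rw [charFun_score_eq (hmodel k) (hregressor k) (hhetero.indep_e k) j₀]
  have hsplit : ∫ ω, Φ k ω * g k ω ∂P
      = ∫ ω, (Φ k ω - (γ k : ℂ)) * g k ω ∂P + (γ k : ℂ) * ∫ ω, g k ω ∂P := by
    rw [← integral_const_mul, ← integral_add (hΦgint k) ((hgint k).const_mul _)]
    congr 1
    ext ω
    ring
  change _ = ∫ ω, Φ k ω * g k ω ∂P
  rw [hsplit]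
  have hprod : (γ k : ℂ) * Complex.exp (((t * ((S k).Se2 P / (S k).Sdeps P) : ℝ) : ℂ)
      * ((0 : ℝ) : ℂ) * Complex.I
        - ((1 : NNReal) : ℂ) * ((t * ((S k).Se2 P / (S k).Sdeps P) : ℝ) : ℂ) ^ 2 / 2)
      = Complex.exp ((t : ℂ) * ((0 : ℝ) : ℂ) * Complex.I
        - ((1 : NNReal) : ℂ) * (t : ℂ) ^ 2 / 2) := by
    simp only [γ]
    rw [Complex.ofReal_exp, ← Complex.exp_add]
    congr 1
    -- The two variance shares add up to one, so the Gaussian factors multiply to the standard one.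
    have hsq : ((S k).Se1 P / (S k).Sdeps P) ^ 2 + ((S k).Se2 P / (S k).Sdeps P) ^ 2 = 1 := by
      rw [div_pow, div_pow, ← add_div, ← Sdeps_sq, div_self (pow_ne_zero 2 (hSd k).ne')]
    have hsq' := congrArg (fun x : ℝ => (x : ℂ)) hsq
    push_cast at hsq' ⊢
    linear_combination (-(t : ℂ) ^ 2 / 2) * hsq'
  rw [mul_sub, hprod]
  ring

end GroupSample

/-! ### Measurability of matrix inverses. -/

section MatrixMeasurability

variable {Ω ι : Type*} [MeasurableSpace Ω] {P : Measure Ω} [Fintype ι] [DecidableEq ι]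
  {A : Ω → Matrix ι ι ℝ}

lemma aemeasurable_matrix_det (hA : ∀ a b, AEMeasurable (fun ω => A ω a b) P) :
    AEMeasurable (fun ω => (A ω).det) P := by
  simp only [Matrix.det_apply']
  exact Finset.aemeasurable_fun_sum _ fun τ _ =>
    AEMeasurable.const_mul (Finset.aemeasurable_fun_prod _ fun i _ => hA _ _) _

/-- Each entry is a cofactor times the inverse of the determinant, with the value 0 at singular
matrices. -/
lemma aemeasurable_matrix_inv_apply (hA : ∀ a b, AEMeasurable (fun ω => A ω a b) P) (a b : ι) :
    AEMeasurable (fun ω => (A ω)⁻¹ a b) P := by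
  simp only [Matrix.inv_def, Ring.inverse_eq_inv', Matrix.smul_apply, smul_eq_mul,
    Matrix.adjugate_apply]
  refine (aemeasurable_matrix_det hA).inv.mul (aemeasurable_matrix_det fun i j => ?_)
  simp only [Matrix.updateRow_apply]
  split_ifs
  · exact aemeasurable_const
  · exact hA _ _

end MatrixMeasurability

/-! ### Linearization of the estimator. -/

namespace GroupSample

variable {Ω : Type*} [MeasurableSpace Ω] {L p : ℕ}

section Single

variable {S : GroupSample Ω L p} {P : Measure Ω} {K : ℝ}

lemma aemeasurable_betaHat (hm : S.IsModel P) (hd : ∀ j, AEMeasurable (S.d j) P) :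
    AEMeasurable S.betaHat P := by
  have he := hm.measurable_e
  have hw := hm.measurable_w
  have hσ : ∀ j l, AEMeasurable (fun ω => S.σ l (S.d j ω)) P := fun j l =>
    (hm.measurable_σ l).comp_aemeasurable (hd j)
  have hX : ∀ u c, AEMeasurable (fun ω => S.X ω u c) P := by
    rintro u (c | c)
    · exact hd u.1
    · change AEMeasurable (fun ω => S.w u.1 u.2 ω c) P
      fun_prop
  have hY : ∀ u, AEMeasurable (fun ω => S.Y ω u) P := fun u => by
    unfold Y y eps
    fun_prop
  have hG : ∀ a b, AEMeasurable (fun ω => ((S.X ω)ᵀ * S.X ω) a b) P := fun a b =>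
    Finset.aemeasurable_fun_sum _ fun u _ => (hX u a).mul (hX u b)
  change AEMeasurable (fun ω => ∑ a, ((S.X ω)ᵀ * S.X ω)⁻¹ (Sum.inl ()) a
    * ∑ u, S.X ω u a * S.Y ω u) P
  exact Finset.aemeasurable_fun_sum _ fun a _ => (aemeasurable_matrix_inv_apply hG _ a).mul
    (Finset.aemeasurable_fun_sum _ fun u _ => (hX u a).mul (hY u))

/-- Natural numbers satisfy n_j ≤ n_j². This serves to show that κ is positive. -/
lemma sqrt_n_le_kappa : √S.n ≤ S.kappa := by
  refine Real.sqrt_le_sqrt ?_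
  rw [← sum_size_eq]
  refine Finset.sum_le_sum fun j _ => ?_
  rw [← Nat.cast_pow, Nat.cast_le]
  exact Nat.le_self_pow two_ne_zero _

/-- Distance of the `t`-statistic from the normalized score on the event that the Gram matrix of
the controls and the second moment of the regressor are well behaved. -/
lemma abs_tStat_sub_le {ω : Ω} {c₀ : ℝ} (hK : 0 < K) (hvar : K⁻¹ ≤ S.varD)
    (hvar' : S.varD ≤ 1 + 16 * K) (hratio : K⁻¹ ≤ S.Se1 P / S.Seps P)
    (hlam : K⁻¹ / 2 ≤ lambdaMin (S.gramW ω)) (hc₀ : c₀ ≠ 0) (hw : ∀ j i, S.w j i ω 0 = c₀)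
    (hq : |S.sqD ω - S.varD| + 2 * K * ‖S.crossDW ω‖ ^ 2 < K⁻¹ / 2) :
    |S.tStat P ω - S.score ω / S.Sdeps P|
      ≤ 2 * K * (|S.score ω / S.Sdeps P|
          * (|S.sqD ω - S.varD| + 2 * K * ‖S.crossDW ω‖ ^ 2))
        + 4 * K ^ 3 * (1 + 16 * K) * ((S.kappa / S.n)⁻¹ * ‖S.crossDW ω‖
          * ‖(S.Seps P * √S.n / S.kappa)⁻¹ • S.crossWEps ω‖) := by
  obtain ⟨hSeps, hSe1, hn, -⟩ := pos_of_inv_le_div hK hratio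
  have hSd : 0 < S.Sdeps P := hSe1.trans_le Se1_le_Sdeps
  have hκ : 0 < S.kappa := (Real.sqrt_pos.2 hn).trans_le sqrt_n_le_kappa
  have hKi : 0 < K⁻¹ := inv_pos.2 hK
  have hv0 : 0 < S.varD := hKi.trans_le hvar
  have hdivK : ∀ x : ℝ, x / (K⁻¹ / 2) = 2 * K * x := fun x => by field_simp
  have hden : ‖S.crossDW ω‖ ^ 2 / (K⁻¹ / 2) < S.sqD ω := by
    rw [hdivK]
    linarith [neg_abs_le (S.sqD ω - S.varD)]
  obtain ⟨η, ρ, hη, hρ, heq⟩ := S.exists_betaHat_sub_mul (half_pos hKi) hlam hc₀ hw hden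
  rw [hdivK] at hη hρ
  set D := S.sqD ω - η with hD
  set δ := |S.sqD ω - S.varD| + 2 * K * ‖S.crossDW ω‖ ^ 2 with hδ
  have hDdiff : |S.varD - D| ≤ δ := by
    have : S.varD - D = -(S.sqD ω - S.varD) + η := by rw [hD]; ring
    rw [this]
    exact (abs_add_le _ _).trans (by rw [abs_neg]; linarith)
  -- The denominator keeps half of the lower bound on σ_d², since its error δ is below K⁻¹/2.
  have hDge : K⁻¹ / 2 ≤ D := by linarith [(abs_le.1 hDdiff).2]
  have hD0 : 0 < D := (half_pos hKi).trans_le hDge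
  have hDinv : D⁻¹ ≤ 2 * K := by
    rw [inv_le_comm₀ hD0 (by positivity)]
    calc (2 * K)⁻¹ = K⁻¹ / 2 := by field_simp
      _ ≤ D := hDge
  -- This separates the effect of replacing the denominator D by σ_d² from the remainder ρ left by
  -- partialling out.
  have hid : S.tStat P ω - S.score ω / S.Sdeps P
      = D⁻¹ * (S.score ω / S.Sdeps P * (S.varD - D)) - D⁻¹ * S.varD * (√S.n * ρ / S.Sdeps P) := by
    have hb : √S.n * (S.betaHat ω - S.β) = D⁻¹ * (S.score ω - √S.n * ρ) := by
      rw [← heq]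
      field_simp
    rw [tStat, hb]
    field_simp
    ring
  have hSK : S.Seps P ≤ K * S.Sdeps P := by
    have h1 : K⁻¹ * S.Seps P ≤ S.Se1 P := (le_div_iff₀ hSeps).1 hratio
    have h2 : K⁻¹ * S.Seps P ≤ S.Sdeps P := h1.trans Se1_le_Sdeps
    calc S.Seps P = K * (K⁻¹ * S.Seps P) := by field_simp
      _ ≤ K * S.Sdeps P := mul_le_mul_of_nonneg_left h2 hK.le
  have hrem : |√S.n * ρ / S.Sdeps P| ≤ 2 * K ^ 2 * ((S.kappa / S.n)⁻¹ * ‖S.crossDW ω‖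
      * ‖(S.Seps P * √S.n / S.kappa)⁻¹ • S.crossWEps ω‖) := by
    have hns : √S.n ^ 2 = S.n := Real.sq_sqrt hn.le
    have hs0 : 0 < √S.n := Real.sqrt_pos.2 hn
    -- The scales κ/n and S_ε√n/κ multiply to S_ε/√n: κ drops out and the factor √n is absorbed.
    have hA : (S.kappa / S.n)⁻¹ * ‖S.crossDW ω‖
        * ‖(S.Seps P * √S.n / S.kappa)⁻¹ • S.crossWEps ω‖
        = √S.n * (‖S.crossDW ω‖ * ‖S.crossWEps ω‖) / S.Seps P := by
      rw [norm_smul, Real.norm_of_nonneg (by positivity)]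
      field_simp
      rw [hns]
      ring
    rw [hA, abs_div, abs_mul, abs_of_pos hs0, abs_of_pos hSd, div_le_iff₀ hSd]
    calc √S.n * |ρ| ≤ √S.n * (2 * K * (‖S.crossDW ω‖ * ‖S.crossWEps ω‖)) := by gcongr
      _ = 2 * K * (√S.n * (‖S.crossDW ω‖ * ‖S.crossWEps ω‖) / S.Seps P) * S.Seps P := by
          field_simp
      _ ≤ 2 * K * (√S.n * (‖S.crossDW ω‖ * ‖S.crossWEps ω‖) / S.Seps P) * (K * S.Sdeps P) := by
          gcongr
      _ = _ := by ring
  rw [hid]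
  refine (abs_sub _ _).trans (add_le_add ?_ ?_)
  · rw [abs_mul, abs_mul, abs_of_pos (inv_pos.2 hD0)]
    gcongr
  · rw [abs_mul, abs_of_pos (mul_pos (inv_pos.2 hD0) hv0)]
    calc D⁻¹ * S.varD * |√S.n * ρ / S.Sdeps P|
        ≤ 2 * K * (1 + 16 * K) * (2 * K ^ 2 * ((S.kappa / S.n)⁻¹ * ‖S.crossDW ω‖
          * ‖(S.Seps P * √S.n / S.kappa)⁻¹ • S.crossWEps ω‖)) := by gcongr
      _ = _ := by ring

end Single

variable {S : ℕ → GroupSample Ω L p} {P : Measure Ω} [IsProbabilityMeasure P] {K : ℝ}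

/-- The cross moments of the centered regressor and the controls are `O_p(κ / n)`. -/
lemma bddInProb_crossDW (hn : ∀ k, 0 < (S k).n)
    (hj : ∀ k, Nonempty (Fin (S k).numGroups)) (hregressor : ∀ k, (S k).RegressorCond P K)
    (hcontrols : ControlsCond S P K) :
    BddInProb P (fun k ω => ((S k).kappa / (S k).n)⁻¹ * ‖(S k).crossDW ω‖) := by
  have hκ : ∀ k, 0 < (S k).kappa / (S k).n := fun k =>
    div_pos ((Real.sqrt_pos.2 (hn k)).trans_le sqrt_n_le_kappa) (hn k)
  have hcoord : ∀ a : Fin (p + 1),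
      BddInProb P (fun k ω => ((S k).kappa / (S k).n)⁻¹ * (S k).crossDW ω a) := by
    intro a
    have hbound := fun k => (hregressor k).integral_crossDW_sq_le (hj k).some
      (hcontrols.memLp_w k) (hcontrols.moment_w k) a
    refine bddInProb_of_integral_sq_le (C := (1 + 16 * K) * K) (fun k => ?_) fun k => ?_
    · simp only [mul_pow]
      exact (hbound k).1.const_mul _
    · simp only [mul_pow]
      rw [integral_const_mul, inv_pow, inv_mul_le_iff₀ (pow_pos (hκ k) 2)]
      exact (hbound k).2.trans_eq (mul_comm _ _)
  refine (BddInProb.sum_abs Finset.univ fun a _ => hcoord a).of_le fun k => ae_of_all _ fun ω => ?_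
  refine le_trans ?_ (le_abs_self _)
  simp only [abs_mul, abs_norm, ← Finset.mul_sum]
  rw [abs_of_pos (inv_pos.2 (hκ k))]
  refine mul_le_mul_of_nonneg_left ?_ (inv_pos.2 (hκ k)).le
  calc ‖(S k).crossDW ω‖ = ‖∑ a, EuclideanSpace.single a ((S k).crossDW ω a)‖ := by
        congr 1
        ext b
        simp
    _ ≤ ∑ a, |(S k).crossDW ω a| := by
        refine (norm_sum_le _ _).trans_eq (Finset.sum_congr rfl fun a _ => ?_)
        rw [PiLp.norm_single, Real.norm_eq_abs]

/-- The linearization of the `t`-statistic. -/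
theorem tendstoInMeasure_tStat_sub (hK : 0 < K) (hcontrols : ControlsCond S P K)
    (hregressor : ∀ k, (S k).RegressorCond P K) (herrors : ErrorsCond S P)
    (hhetero : HeteroCond S P K)
    (hscore : BddInProb P (fun k ω => (S k).score ω / (S k).Sdeps P)) :
    TendstoInMeasure P
      (fun k ω => (S k).tStat P ω - (S k).score ω / (S k).Sdeps P) atTop (fun _ => (0 : ℝ)) := by
  have hpos := fun k => pos_of_inv_le_div hK (hhetero.Se1_ge k)
  have hn : ∀ k, 0 < (S k).n := fun k => (hpos k).2.2.1
  have hj : ∀ k, Nonempty (Fin (S k).numGroups) := fun k => (hpos k).2.2.2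
  have hκ : ∀ k, 0 < (S k).kappa / (S k).n := fun k =>
    div_pos ((Real.sqrt_pos.2 (hn k)).trans_le sqrt_n_le_kappa) (hn k)
  obtain ⟨R, hR, hRle⟩ := hcontrols.lambdaMin_ge
  have hq := bddInProb_crossDW hn hj hregressor hcontrols
  have hq0 : TendstoInMeasure P (fun k ω => ‖(S k).crossDW ω‖) atTop (fun _ => (0 : ℝ)) := by
    refine tendstoInMeasure_zero_of_le
      (hq.mul_tendstoInMeasure_zero (tendstoInMeasure_zero_of_tendsto herrors.size))
      fun k => ae_of_all _ fun ω => ?_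
    have := (hκ k).ne'
    rw [mul_right_comm, inv_mul_cancel₀ this, one_mul]
  have hqsq : TendstoInMeasure P (fun k ω => 2 * K * ‖(S k).crossDW ω‖ ^ 2) atTop
      (fun _ => (0 : ℝ)) := by
    refine tendstoInMeasure_zero_const_mul (2 * K) ?_
    -- Once the norm is below 1, its square is at most the norm itself.
    refine tendstoInMeasure_zero_of_le_of_lt one_pos hq0 hq0 fun k => ae_of_all _ fun ω h1 => ?_
    rw [abs_norm] at h1 ⊢
    rw [abs_of_nonneg (sq_nonneg _)]
    nlinarith [norm_nonneg ((S k).crossDW ω)]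
  have hsqD : TendstoInMeasure P (fun k ω => (S k).sqD ω - (S k).varD) atTop
      (fun _ => (0 : ℝ)) := by
    have hbound := fun k => (hregressor k).integral_sqD_sub_sq_le (hj k).some (hn k).ne'
    refine tendstoInMeasure_zero_of_integral_sq_le (fun k => (hbound k).1)
      (fun k => (hbound k).2) ?_
    simpa using (herrors.size.pow 2).const_mul (16 * K)
  have hδ : TendstoInMeasure P
      (fun k ω => |(S k).sqD ω - (S k).varD| + 2 * K * ‖(S k).crossDW ω‖ ^ 2) atTop
      (fun _ => (0 : ℝ)) := tendstoInMeasure_zero_add (tendstoInMeasure_zero_abs hsqD) hqsq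
  have hWeps : TendstoInMeasure P (fun k ω =>
      ‖((S k).Seps P * √(S k).n / (S k).kappa)⁻¹ • (S k).crossWEps ω‖) atTop
      (fun _ => (0 : ℝ)) := by
    rw [tendstoInMeasure_zero_iff]
    simp only [abs_norm]
    have := tendstoInMeasure_iff_norm.1 herrors.orthogonality
    simpa only [sub_zero] using! this
  have habs : BddInProb P (fun k ω => |(S k).score ω / (S k).Sdeps P|) :=
    hscore.of_le fun k => ae_of_all _ fun ω => by rw [abs_abs]
  have hmain := tendstoInMeasure_zero_add
    (tendstoInMeasure_zero_const_mul (2 * K) (habs.mul_tendstoInMeasure_zero hδ))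
    (tendstoInMeasure_zero_const_mul (4 * K ^ 3 * (1 + 16 * K))
      (hq.mul_tendstoInMeasure_zero hWeps))
  -- On the event |R| + δ < K⁻¹/2 both requirements hold at once: the smallest eigenvalue is at
  -- least K⁻¹/2 and the denominator stays away from zero.
  refine tendstoInMeasure_zero_of_le_of_lt (c := K⁻¹ / 2) (half_pos (inv_pos.2 hK)) hmain
    (tendstoInMeasure_zero_add (tendstoInMeasure_zero_abs hR) hδ) fun k => ?_
  filter_upwards [hRle k] with ω hω hlt
  obtain ⟨c₀, hc₀, hw⟩ := hcontrols.intercept k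
  have hδ0 : 0 ≤ |(S k).sqD ω - (S k).varD| + 2 * K * ‖(S k).crossDW ω‖ ^ 2 := by positivity
  have hlt' := (le_abs_self _).trans_lt hlt
  refine (abs_tStat_sub_le hK (hregressor k).varD_ge ((hregressor k).varD_le (hj k).some)
    (hhetero.Se1_ge k) ?_ hc₀ (fun j i => hw j i ω) ?_).trans (le_abs_self _)
  · linarith [neg_abs_le (R k ω)]
  · linarith [abs_nonneg (R k ω)]

end GroupSample

/-! ### Conclusion by Slutsky's lemma. -/

open GroupSample in
/-- Let `S k`, `k = 0, 1, …`, be a sequence of grouped samples of sizes `n = (S k).n`; the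
conditions imply `n > 0` for every `k` and `n → ∞`. -/
theorem theorem4 {Ω : Type*} [MeasurableSpace Ω] (P : Measure Ω) [IsProbabilityMeasure P]
    {L p : ℕ} (S : ℕ → GroupSample Ω L p) (K : ℝ) (hK : 0 < K)
    (hmodel : ∀ k, (S k).IsModel P)
    (hcontrols : ControlsCond S P K)
    (hregressor : ∀ k, (S k).RegressorCond P K)
    (herrors : ErrorsCond S P)
    (hhetero : HeteroCond S P K)
    (hlatent : LatentCond S P) :
    TendstoInMeasure P
      (fun k ω => (S k).tStat P ω - (S k).score ω / (S k).Sdeps P) atTop (fun _ => (0 : ℝ)) ∧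
    TendstoInDistribution (fun k ω => (S k).tStat P ω) atTop id (fun _ => P)
      (gaussianReal 0 1) := by
  -- The limit theorem comes first because it also supplies the boundedness in probability of the
  -- score that the linearization uses.
  have hclt := tendstoInDistribution_score hK hmodel hregressor hhetero hlatent
  have hlin := tendstoInMeasure_tStat_sub hK hcontrols hregressor herrors hhetero
    (bddInProb_of_tendstoInDistribution hclt)
  refine ⟨hlin, tendstoInDistribution_of_tendstoInMeasure_sub _ _ hclt hlin fun k => ?_⟩
  have hβ := aemeasurable_betaHat (hmodel k) fun j => ((hregressor k).hasLaw j).aemeasurable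
  unfold tStat
  fun_prop
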